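/- Let $X$ and $\mathcal F$ be complex Banach spaces and let $\langle\cdot,\cdot\rangle\colon X\times\mathcal F\to\mathbb C$ be a bilinear pairing making $(X,\mathcal F)$ a dual pair of Banach spaces, i.e. $\|x\|=\sup_{\|\varphi\|\le1}|\langle x,\varphi\rangle|$ for all $x\in X$ and $\|\varphi\|=\sup_{\|x\|\le1}|\langle x,\varphi\rangle|$ for all $\varphi\in\mathcal F$. Let $\sigma(X,\mathcal F)$ be the weak topology on $X$ given by the pairing. Assume that $(X,\mathcal F)$ has the Krein property, i.e. the $\sigma(X,\mathcal F)$-closed convex hull of every $\sigma(X,\mathcal F)$-compact subset of $X$ is $\sigma(X,\mathcal F)$-compact, and that $(\mathcal F,X)$ has the Krein property as well. Let $U=(U_t)_{t\in\mathbb R}$ be a one-parameter group of isometries of $X$ such that every $U_t$ is a $\sigma(X,\mathcal F)$-continuous linear map and every orbit $t\mapsto U_tx$ is $\sigma(X,\mathcal F)$-continuous. Its analytic generator $U_i$ is the operator on $X$ defined by: $x\in D(U_i)$ and $U_ix=y$ if and only if there is a $\sigma(X,\mathcal F)$-continuous function $f\colon\{w\in\mathbb C: 0\le\operatorname{Im}w\le1\}\to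 X$, holomorphic inside the strip (i.e. $w\mapsto\langle f(w),\varphi\rangle$ is holomorphic for every $\varphi\in\mathcal F$), such that $f(t)=U_tx$ for all $t\in\mathbb R$ and $f(i)=y$. Let $\mathrm{Graph}(U_i)=\{(x,U_ix):x\in D(U_i)\}\subset X\times X$, and let $\Delta=\begin{pmatrix}U_i&0\\0&U_i\end{pmatrix}$ be the operator on $\mathrm{Graph}(U_i)$ with domain $D(\Delta)=\{(x,x')\in\mathrm{Graph}(U_i): x,x'\in D(U_i)\}$ and $\Delta(x,x')=(U_ix,U_ix')$. The resolvent $R(\Delta,c)$ is the bounded inverse $(\Delta-cI)^{-1}$, defined on all of $\mathrm{Graph}(U_i)$, when it exists, and $\mathrm{Sp}\,\Delta$ is the set of those $c\in\mathbb C$ for which it does not exist. Then $$\mathrm{Sp}\,\Delta\subset\mathbb R_+=[0,\infty).$$ Moreover, for every $\mu\in\mathbb C\setminus(-\infty,0]$ the function $F_\mu(t)=\dfrac{t\,\mu^{it-1}}{e^{\pi t}-e^{-\pi t}}$ (principal branch of the power) is integrable on $\mathbb R$; there is a bounded, $\sigma(X,\mathcal F)$-continuous linear operator $Q_\mu=\int_{\mathbb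 R}F_\mu(t)\,U_t\,dt$ on $X$, i.e. $\langle Q_\mu x,\varphi\rangle=\int_{\mathbb R}F_\mu(t)\langle U_tx,\varphi\rangle\,dt$ for all $x\in X$, $\varphi\in\mathcal F$, the integrals being absolutely convergent; and $-\mu$ lies in the resolvent set of $\Delta$, with $$R(\Delta,-\mu)=\begin{pmatrix}-Q_\mu+\frac1\mu I&-\frac1\mu Q_\mu\\ \mu Q_\mu&Q_\mu\end{pmatrix}\quad\text{on }\mathrm{Graph}(U_i).$$ -/

import Mathlib

noncomputable section

section DualPair

variable {X F : Type*} [NormedAddCommGroup X] [NormedSpace ℂ X]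
  [NormedAddCommGroup F] [NormedSpace ℂ F]

/-- A bilinear pairing `B = ⟨·, ·⟩` makes `(X, F)` a dual pair of normed spaces if each of the
two norms is the dual norm given by the pairing:
`‖x‖ = sup {|⟨x, φ⟩| : ‖φ‖ ≤ 1}` and `‖φ‖ = sup {|⟨x, φ⟩| : ‖x‖ ≤ 1}`. -/
structure IsDualPair (B : X →ₗ[ℂ] F →ₗ[ℂ] ℂ) : Prop where
  norm_left : ∀ x : X, IsLUB {r : ℝ | ∃ φ : F, ‖φ‖ ≤ 1 ∧ r = ‖B x φ‖} ‖x‖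
  norm_right : ∀ φ : F, IsLUB {r : ℝ | ∃ x : X, ‖x‖ ≤ 1 ∧ r = ‖B x φ‖} ‖φ‖

/-- The weak topology `σ(X, F)` on `X`: the coarsest topology for which all the functionals
`x ↦ ⟨x, φ⟩`, `φ ∈ F`, are continuous (the topology of Mathlib's `WeakBilin B`, put on `X`). -/
@[reducible] def weakTopology (B : X →ₗ[ℂ] F →ₗ[ℂ] ℂ) : TopologicalSpace X :=
  TopologicalSpace.induced (fun (x : X) (φ : F) => B x φ) Pi.topologicalSpace

/-- The Krein property of `(X, F)`: the `σ(X, F)`-closed convex hull of any `σ(X, F)`-compact set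
is `σ(X, F)`-compact. -/
def KreinProperty (B : X →ₗ[ℂ] F →ₗ[ℂ] ℂ) : Prop :=
  ∀ K : Set X, @IsCompact X (weakTopology B) K →
    @IsCompact X (weakTopology B) (@closure X (weakTopology B) (convexHull ℝ K))

/-- `σ(X, F)`-continuity of a bounded operator on `X`, that is, membership in `B_F(X)`. -/
def IsWeakContinuous (B : X →ₗ[ℂ] F →ₗ[ℂ] ℂ) (T : X →L[ℂ] X) : Prop :=
  @Continuous X X (weakTopology B) (weakTopology B) (fun x => T x)

/-- A `σ(X, F)`-continuous one-parameter group of isometries in `B_F(X)`. -/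
structure IsIsometryGroup (B : X →ₗ[ℂ] F →ₗ[ℂ] ℂ) (U : ℝ → X →L[ℂ] X) : Prop where
  map_zero : U 0 = ContinuousLinearMap.id ℂ X
  map_add : ∀ s t : ℝ, U (s + t) = (U s).comp (U t)
  isometry : ∀ t : ℝ, Isometry (U t)
  weakContinuous : ∀ t : ℝ, IsWeakContinuous B (U t)
  continuous_orbit : ∀ x : X, @Continuous ℝ X _ (weakTopology B) (fun t => U t x)

/-- The closed strip `{w : Im w * Im z ≥ 0, |Im w| ≤ |Im z|}`. -/
def strip (z : ℂ) : Set ℂ := {w : ℂ | 0 ≤ w.im * z.im ∧ |w.im| ≤ |z.im|}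

/-- `f` is a `σ(X, F)`-continuous extension of the orbit `t ↦ U t x` to the closed strip of `z`,
holomorphic (with respect to `σ(X, F)`) inside the strip. -/
structure IsOrbitExtension (B : X →ₗ[ℂ] F →ₗ[ℂ] ℂ) (U : ℝ → X →L[ℂ] X) (z : ℂ) (x : X)
    (f : ℂ → X) : Prop where
  continuousOn : @ContinuousOn ℂ X _ (weakTopology B) f (strip z)
  holomorphic : ∀ φ : F, DifferentiableOn ℂ (fun w : ℂ => B (f w) φ) (interior (strip z))
  eq_orbit : ∀ t : ℝ, f (t : ℂ) = U t x

theorem continuousOn_weakTopology_iff (B : X →ₗ[ℂ] F →ₗ[ℂ] ℂ) {f : ℂ → X} {s : Set ℂ} :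
    @ContinuousOn ℂ X _ (weakTopology B) f s ↔
      ∀ φ : F, ContinuousOn (fun w : ℂ => B (f w) φ) s := by
  let _ := weakTopology B
  have hi : Topology.IsInducing (fun (x : X) (φ : F) => B x φ) := ⟨rfl⟩
  exact hi.continuousOn_iff.trans continuousOn_pi

theorem IsOrbitExtension.continuousOn_pairing {B : X →ₗ[ℂ] F →ₗ[ℂ] ℂ} {U : ℝ → X →L[ℂ] X}
    {z : ℂ} {x : X} {f : ℂ → X} (hf : IsOrbitExtension B U z x f) (φ : F) :
    ContinuousOn (fun w : ℂ => B (f w) φ) (strip z) :=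
  (continuousOn_weakTopology_iff B).1 hf.continuousOn φ

theorem IsOrbitExtension.add {B : X →ₗ[ℂ] F →ₗ[ℂ] ℂ} {U : ℝ → X →L[ℂ] X} {z : ℂ} {x y : X}
    {f g : ℂ → X} (hf : IsOrbitExtension B U z x f) (hg : IsOrbitExtension B U z y g) :
    IsOrbitExtension B U z (x + y) (fun w => f w + g w) where
  continuousOn := (continuousOn_weakTopology_iff B).2 fun φ => by
    simpa using! (hf.continuousOn_pairing φ).add (hg.continuousOn_pairing φ)
  holomorphic φ := by
    simpa using! (hf.holomorphic φ).add (hg.holomorphic φ)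
  eq_orbit t := by simp [hf.eq_orbit, hg.eq_orbit]

theorem IsOrbitExtension.smul {B : X →ₗ[ℂ] F →ₗ[ℂ] ℂ} {U : ℝ → X →L[ℂ] X} {z : ℂ} {x : X}
    {f : ℂ → X} (hf : IsOrbitExtension B U z x f) (c : ℂ) :
    IsOrbitExtension B U z (c • x) (fun w => c • f w) where
  continuousOn := (continuousOn_weakTopology_iff B).2 fun φ => by
    simpa using! continuousOn_const.mul (hf.continuousOn_pairing φ)
  holomorphic φ := by
    simpa using (hf.holomorphic φ).const_mul c
  eq_orbit t := by simp [hf.eq_orbit]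

/-- The graph of `U_z`: the pairs `(x, y)` such that the orbit of `x` has a `σ(X, F)`-continuous
extension `f` to the closed strip of `z`, holomorphic inside, with `f z = y`. -/
def powGraph (B : X →ₗ[ℂ] F →ₗ[ℂ] ℂ) (U : ℝ → X →L[ℂ] X) (z : ℂ) : Submodule ℂ (X × X) where
  carrier := {p | ∃ f : ℂ → X, IsOrbitExtension B U z p.1 f ∧ f z = p.2}
  zero_mem' := ⟨fun _ => 0, ⟨(continuousOn_weakTopology_iff B).2 fun φ => continuousOn_const, fun φ => by simp, fun t => by simp⟩, rfl⟩
  add_mem' := by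
    rintro p q ⟨f, hf, hfz⟩ ⟨g, hg, hgz⟩
    exact ⟨_, hf.add hg, by simp [hfz, hgz]⟩
  smul_mem' := by
    rintro c p ⟨f, hf, hfz⟩
    exact ⟨_, hf.smul c, by simp [hfz]⟩

/-- The operator `U_z`, with graph `powGraph B U z` (see `graph_groupPow`). -/
def groupPow (B : X →ₗ[ℂ] F →ₗ[ℂ] ℂ) (U : ℝ → X →L[ℂ] X) (z : ℂ) : X →ₗ.[ℂ] X :=
  (powGraph B U z).toLinearPMap

/-- The analytic generator `U_i`. -/
def analyticGenerator (B : X →ₗ[ℂ] F →ₗ[ℂ] ℂ) (U : ℝ → X →L[ℂ] X) : X →ₗ.[ℂ] X :=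
  groupPow B U Complex.I

end DualPair

section WellDefined

/-- A continuous function on the closed strip `0 ≤ Im w ≤ 1`, holomorphic inside, that vanishes
on the real axis vanishes identically. -/
theorem eq_zero_of_unit_strip {f : ℂ → ℂ}
    (hc : ContinuousOn f {w : ℂ | 0 ≤ w.im ∧ w.im ≤ 1})
    (hd : DifferentiableOn ℂ f {w : ℂ | 0 < w.im ∧ w.im < 1})
    (h0 : ∀ t : ℝ, f t = 0) {w : ℂ} (hw0 : 0 ≤ w.im) (hw1 : w.im ≤ 1) : f w = 0 := by
  -- near the real axis: the product of the four rotations of `f` about `c` vanishes on the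
  -- boundary of a square centred at `c`
  have key : ∀ c : ℂ, 0 < c.im → c.im < 1 / 2 → f c = 0 := by
    intro c hc0 hc1
    set S : Set ℂ := {w | |w.re| < c.im ∧ |w.im| < c.im} with hS
    have hSo : IsOpen S :=
      (isOpen_lt Complex.continuous_re.abs continuous_const).and
        (isOpen_lt Complex.continuous_im.abs continuous_const)
    have hScl : closure S ⊆ {w | |w.re| ≤ c.im ∧ |w.im| ≤ c.im} := by
      refine closure_minimal (fun w hw => ⟨hw.1.le, hw.2.le⟩) ?_
      exact (isClosed_le Complex.continuous_re.abs continuous_const).and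
        (isClosed_le Complex.continuous_im.abs continuous_const)
    have hSb : Bornology.IsBounded S := by
      refine (Metric.isBounded_closedBall (x := (0 : ℂ)) (r := c.im + c.im)).subset ?_
      intro w hw
      rw [mem_closedBall_zero_iff]
      exact (Complex.norm_le_abs_re_add_abs_im w).trans (add_le_add hw.1.le hw.2.le)
    have hdc : ∀ u : ℂ, (∀ w ∈ closure S, |(u * w).im| ≤ c.im) →
        (∀ w ∈ S, |(u * w).im| < c.im) → DiffContOnCl ℂ (fun w => f (c + u * w)) S := by
      intro u h1 h2
      refine ⟨hd.comp (by fun_prop) ?_, hc.comp (by fun_prop) ?_⟩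
      · intro w hw
        have := abs_lt.1 (h2 w hw)
        simp only [Set.mem_ofPred_eq, Complex.add_im]
        constructor <;> linarith
      · intro w hw
        have := abs_le.1 (h1 w hw)
        simp only [Set.mem_ofPred_eq, Complex.add_im]
        constructor <;> linarith
    have e1 := hdc 1 (fun w hw => by simpa using (hScl hw).2) (fun w hw => by simpa using hw.2)
    have e2 := hdc (-1) (fun w hw => by simpa using (hScl hw).2) (fun w hw => by simpa using hw.2)
    have e3 := hdc Complex.I (fun w hw => by simpa using (hScl hw).1)
      (fun w hw => by simpa using hw.1)
    have e4 := hdc (-Complex.I) (fun w hw => by simpa using (hScl hw).1)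
      (fun w hw => by simpa using hw.1)
    have hreal : ∀ v : ℂ, v.im = 0 → f v = 0 := by
      intro v hv
      rw [show v = ((v.re : ℝ) : ℂ) from Complex.ext (by simp) (by simpa using hv)]
      exact h0 _
    have hfr : Set.EqOn (fun w => (f (c + 1 * w) * f (c + (-1) * w)) *
        (f (c + Complex.I * w) * f (c + (-Complex.I) * w))) (fun _ => 0) (frontier S) := by
      intro w hw
      have h1 := hScl hw.1
      have h2 : w ∉ S := by
        have := hw.2
        rwa [hSo.interior_eq] at this
      have h3 : |w.re| = c.im ∨ |w.im| = c.im := by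
        by_contra! h
        exact h2 ⟨lt_of_le_of_ne h1.1 h.1, lt_of_le_of_ne h1.2 h.2⟩
      rcases h3 with h3 | h3
      · rcases eq_or_eq_neg_of_abs_eq h3 with h3 | h3
        · have h4 := hreal (c + (-Complex.I) * w) (by simp [h3])
          simp only [h4, mul_zero]
        · have h4 := hreal (c + Complex.I * w) (by simp [h3])
          simp only [h4, mul_zero, zero_mul]
      · rcases eq_or_eq_neg_of_abs_eq h3 with h3 | h3
        · have h4 := hreal (c + (-1) * w) (by simp [h3])
          simp only [h4, mul_zero, zero_mul]
        · have h4 := hreal (c + 1 * w) (by simp [h3])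
          simp only [h4, zero_mul]
    have hprod : DiffContOnCl ℂ (fun w => (f (c + 1 * w) * f (c + (-1) * w)) *
        (f (c + Complex.I * w) * f (c + (-Complex.I) * w))) S :=
      ⟨(e1.1.mul e2.1).mul (e3.1.mul e4.1), (e1.2.mul e2.2).mul (e3.2.mul e4.2)⟩
    have h0S : (0 : ℂ) ∈ S := by simp [hS, hc0]
    have := Complex.eqOn_of_eqOn_frontier hSb hprod diffContOnCl_const hfr h0S
    simpa using this
  -- the identity principle inside the strip
  have hO : IsOpen {w : ℂ | 0 < w.im ∧ w.im < 1} :=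
    (isOpen_lt continuous_const Complex.continuous_im).and
      (isOpen_lt Complex.continuous_im continuous_const)
  have hconv : Convex ℝ {w : ℂ | 0 < w.im ∧ w.im < 1} :=
    (convex_halfSpace_im_gt 0).inter (convex_halfSpace_im_lt 1)
  have hin : Set.EqOn f 0 {w : ℂ | 0 < w.im ∧ w.im < 1} := by
    refine (hd.analyticOnNhd hO).eqOn_zero_of_preconnected_of_eventuallyEq_zero
      hconv.isPreconnected (z₀ := Complex.I / 4) ?_ ?_
    · simp only [Set.mem_ofPred_eq]
      norm_num
    · have hU : {w : ℂ | 0 < w.im ∧ w.im < 1 / 2} ∈ nhds (Complex.I / 4) := by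
        refine IsOpen.mem_nhds ((isOpen_lt continuous_const Complex.continuous_im).and
          (isOpen_lt Complex.continuous_im continuous_const)) ?_
        simp only [Set.mem_ofPred_eq]
        norm_num
      filter_upwards [hU] with w hw using key w hw.1 hw.2
  have hcl : {w : ℂ | 0 ≤ w.im ∧ w.im ≤ 1} ⊆ closure {w : ℂ | 0 < w.im ∧ w.im < 1} := by
    intro w hw
    have h := Complex.closure_preimage_im (Set.Ioo (0 : ℝ) 1)
    rw [closure_Ioo (by norm_num)] at h
    have hw' : w ∈ Complex.im ⁻¹' Set.Icc (0 : ℝ) 1 := hw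
    rw [← h] at hw'
    exact hw'
  exact hin.of_subset_closure hc continuousOn_const (fun w hw => ⟨hw.1.le, hw.2.le⟩) hcl
    (show w ∈ {w : ℂ | 0 ≤ w.im ∧ w.im ≤ 1} from ⟨hw0, hw1⟩)

variable {X F : Type*} [NormedAddCommGroup X] [NormedSpace ℂ X]
  [NormedAddCommGroup F] [NormedSpace ℂ F]

theorem IsDualPair.eq_zero {B : X →ₗ[ℂ] F →ₗ[ℂ] ℂ} (hB : IsDualPair B) {x : X}
    (hx : ∀ φ : F, B x φ = 0) : x = 0 := by
  have h := (hB.norm_left x).2 (show (0 : ℝ) ∈ _ by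
    rintro r ⟨φ, -, rfl⟩
    simp [hx φ])
  exact norm_le_zero_iff.1 h

/-- `powGraph B U z` is single valued. -/
theorem powGraph_snd_eq_zero {B : X →ₗ[ℂ] F →ₗ[ℂ] ℂ} (hB : IsDualPair B) (U : ℝ → X →L[ℂ] X)
    (z : ℂ) (p : X × X) (hp : p ∈ powGraph B U z) (hp1 : p.1 = 0) : p.2 = 0 := by
  obtain ⟨f, hf, hfz⟩ := hp
  have hreal : ∀ t : ℝ, f t = 0 := fun t => by rw [hf.eq_orbit t, hp1, map_zero]
  rw [← hfz]
  by_cases hz : z.im = 0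
  · rw [show z = ((z.re : ℝ) : ℂ) from Complex.ext (by simp) (by simpa using hz)]
    exact hreal _
  refine hB.eq_zero fun φ => ?_
  have hpos : 0 < z.im * z.im := mul_self_pos.2 hz
  have habs : 0 < |z.im| := abs_pos.2 hz
  have hm : Set.MapsTo (fun v : ℂ => (z.im : ℂ) * v) {w : ℂ | 0 ≤ w.im ∧ w.im ≤ 1} (strip z) := by
    rintro v ⟨hv0, hv1⟩
    simp only [strip, Set.mem_ofPred_eq, Complex.im_ofReal_mul, abs_mul,
      abs_of_nonneg hv0]
    exact ⟨by nlinarith, by nlinarith⟩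
  have hO : IsOpen {w : ℂ | 0 < w.im ∧ w.im < 1} :=
    (isOpen_lt continuous_const Complex.continuous_im).and
      (isOpen_lt Complex.continuous_im continuous_const)
  have hmi : Set.MapsTo (fun v : ℂ => (z.im : ℂ) * v) {w : ℂ | 0 < w.im ∧ w.im < 1}
      (interior (strip z)) := by
    have hT : IsOpen {w : ℂ | 0 < w.im * z.im ∧ |w.im| < |z.im|} :=
      (isOpen_lt continuous_const (Complex.continuous_im.mul continuous_const)).and
        (isOpen_lt Complex.continuous_im.abs continuous_const)
    have hTi : {w : ℂ | 0 < w.im * z.im ∧ |w.im| < |z.im|} ⊆ interior (strip z) :=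
      interior_maximal (fun w hw => ⟨hw.1.le, hw.2.le⟩) hT
    rintro v ⟨hv0, hv1⟩
    refine hTi ?_
    simp only [Set.mem_ofPred_eq, Complex.im_ofReal_mul, abs_mul, abs_of_pos hv0]
    exact ⟨by nlinarith, by nlinarith⟩
  have h := eq_zero_of_unit_strip (f := fun v => B (f ((z.im : ℂ) * v)) φ)
    ((hf.continuousOn_pairing φ).comp (by fun_prop) hm)
    ((hf.holomorphic φ).comp (by fun_prop) hmi)
    (fun t => by
      have := hreal (z.im * t)
      push_cast at this
      simp [this])
    (w := z / (z.im : ℂ)) (by simp [hz]) (by simp [hz])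
  have hz' : (z.im : ℂ) ≠ 0 := by exact_mod_cast hz
  rwa [mul_div_cancel₀ z hz'] at h

/-- `groupPow B U z` is the operator with graph `powGraph B U z`. -/
theorem graph_groupPow {B : X →ₗ[ℂ] F →ₗ[ℂ] ℂ} (hB : IsDualPair B) (U : ℝ → X →L[ℂ] X) (z : ℂ) :
    (groupPow B U z).graph = powGraph B U z :=
  Submodule.toLinearPMap_graph_eq _ (powGraph_snd_eq_zero hB U z)

end WellDefined

section Operators

/-- The ampliation `diag(T, T)` of an operator `T` on `X` onto its graph: its domain consists of
the `(x, x') ∈ Graph T` with `x, x' ∈ D(T)`, and it sends `(x, x')` to `(T x, T x')`. -/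
def ampliation {X : Type*} [NormedAddCommGroup X] [NormedSpace ℂ X] (T : X →ₗ.[ℂ] X) :
    T.graph →ₗ.[ℂ] T.graph where
  domain :=
    { carrier := {p | (p : X × X).1 ∈ T.domain ∧ (p : X × X).2 ∈ T.domain}
      zero_mem' := ⟨T.domain.zero_mem, T.domain.zero_mem⟩
      add_mem' := fun hp hq => ⟨T.domain.add_mem hp.1 hq.1, T.domain.add_mem hp.2 hq.2⟩
      smul_mem' := fun c _ hp => ⟨T.domain.smul_mem c hp.1, T.domain.smul_mem c hp.2⟩ }
  toFun :=
    { toFun := fun p => ⟨(T ⟨(p.1 : X × X).1, p.2.1⟩, T ⟨(p.1 : X × X).2, p.2.2⟩), by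
        obtain ⟨⟨⟨x, x'⟩, hp⟩, hx, hx'⟩ := p
        obtain ⟨y, hy, hy'⟩ := (LinearPMap.mem_graph_iff T).1 hp
        simp only at hy hy' hx hx' ⊢
        have : T ⟨x, hx⟩ = x' := by
          rw [← hy']
          congr 1
          exact Subtype.ext hy.symm
        rw [this]
        exact LinearPMap.mem_graph T ⟨x', hx'⟩⟩
      map_add' := fun p q => Subtype.ext (Prod.ext
        (T.toFun.map_add ⟨(p.1 : X × X).1, p.2.1⟩ ⟨(q.1 : X × X).1, q.2.1⟩)
        (T.toFun.map_add ⟨(p.1 : X × X).2, p.2.2⟩ ⟨(q.1 : X × X).2, q.2.2⟩))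
      map_smul' := fun c p => Subtype.ext (Prod.ext
        (T.toFun.map_smul c ⟨(p.1 : X × X).1, p.2.1⟩)
        (T.toFun.map_smul c ⟨(p.1 : X × X).2, p.2.2⟩)) }

/-- `R` is the resolvent `R(T, c) = (T - c I)⁻¹` of the (unbounded) operator `T` on `E`:
a bounded two-sided inverse of `T - c I : D(T) → E`, defined on the whole of `E`. -/
structure IsResolventAt {E : Type*} [NormedAddCommGroup E] [NormedSpace ℂ E]
    (T : E →ₗ.[ℂ] E) (c : ℂ) (R : E →L[ℂ] E) : Prop where
  left_inv : ∀ x : T.domain, R (T x - c • (x : E)) = x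
  mem_domain : ∀ y : E, R y ∈ T.domain
  right_inv : ∀ y : E, T ⟨R y, mem_domain y⟩ - c • R y = y

/-- The spectrum of an (unbounded) operator `T` on `E`. -/
def pmapSpectrum {E : Type*} [NormedAddCommGroup E] [NormedSpace ℂ E]
    (T : E →ₗ.[ℂ] E) : Set ℂ :=
  {c : ℂ | ¬ ∃ R : E →L[ℂ] E, IsResolventAt T c R}

/-- `F_μ(t) = t μ^(it-1) / (e^(πt) - e^(-πt))`, with the principal branch of the power. (The value
at the removable singularity `t = 0` does not matter, as `F_μ` is only ever integrated.) -/
def kernelF (μ : ℂ) (t : ℝ) : ℂ :=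
  (t : ℂ) * μ ^ (Complex.I * (t : ℂ) - 1) /
    (Complex.exp (Real.pi * t) - Complex.exp (-(Real.pi * t)))

/-- `y = ∫ k(t) x(t) dt` in the sense of `σ(X, F)`: `⟨y, φ⟩ = ∫ k(t) ⟨x(t), φ⟩ dt` for all `φ`, with
convergent integrals. -/
def IsWeakIntegral {X F : Type*} [NormedAddCommGroup X] [NormedSpace ℂ X]
    [NormedAddCommGroup F] [NormedSpace ℂ F] (B : X →ₗ[ℂ] F →ₗ[ℂ] ℂ)
    (k : ℝ → ℂ) (x : ℝ → X) (y : X) : Prop :=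
  ∀ φ : F, MeasureTheory.Integrable (fun t : ℝ => k t * B (x t) φ) ∧
    B y φ = ∫ t : ℝ, k t * B (x t) φ

/-- The operator matrix `[[-Q + μ⁻¹ I, -μ⁻¹ Q], [μ Q, Q]]` on `X × X`. -/
def resolventMatrix {X : Type*} [NormedAddCommGroup X] [NormedSpace ℂ X]
    (μ : ℂ) (Q : X →L[ℂ] X) : X × X →L[ℂ] X × X :=
  ((-Q + μ⁻¹ • ContinuousLinearMap.id ℂ X).coprod (-(μ⁻¹ • Q))).prod ((μ • Q).coprod Q)

end Operators

end

noncomputable section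

open MeasureTheory Filter Topology ProbabilityTheory

/-! ### Weak integrals in dual pairs with the Krein property -/

section WeakIntegrals

variable {X F : Type*} [NormedAddCommGroup X] [NormedSpace ℂ X]
  [NormedAddCommGroup F] [NormedSpace ℂ F]

/-! Write `T` for the analytic generator, so that formally `U_t = T^{-it}`. For `λ > 0` the Mellin
formula `∫ F_μ(t) λ^{-it} dt = λ/(λ+μ)²` suggests `Q_μ = T(T+μ)⁻²`. This is a bounded operator: the
kernel decays exponentially because `|arg μ| < π`, and the factor `t` cancels the zero of `sinh
(πt)` at the origin. The kernel of `(T+μ)⁻¹` itself would have a pole there, which is why the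
resolvent is sought on the graph of `T` rather than on `X`. With `q = λ/(λ+μ)²` one has `1/(λ+μ) =
1/μ - q - λq/μ` and `λ/(λ+μ) = μq + λq`; writing `x'` for `λx`, these are the two rows of the
matrix.

Two facts about the graph make this rigorous: `Q` commutes with `T`, and `T Q x' = x' - 2μ Q x' - μ²
Q x` whenever `x' = T x`, a form of `(T+μ)² Q = T`. Given these, `exists_isResolventAt_ampliation`
is linear algebra. The first holds because `Q` is weakly continuous and commutes with every `U_t`,
so it carries orbit extensions to orbit extensions.

The second (`powGraph_integral_kernelE`) is a contour argument. If `f` extends the orbit of `x`,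
then the orbit of `Q x'` extends by `w ↦ μ⁻¹ ∫ E_μ(t - w) f(t + i) dt` as long as `Im w < 1`. When
`w` approaches the top line, a pole meets the contour. Lowering the contour past the pole beforehand
produces the residue `f(w)` plus an integral that is continuous up to `Im w = 1`, and the functional
equation of `E_μ` under `z ↦ z - i` evaluates it at `w = i`.

The Krein property of `(X, F)` ensures that weak integrals are vectors of `X`; that of `(F, X)`
gives `Q` an adjoint on `F`, hence weak continuity. The spectral inclusion is the case `μ = -c`. -/

theorem IsDualPair.norm_le_mul {B : X →ₗ[ℂ] F →ₗ[ℂ] ℂ} (hB : IsDualPair B) (x : X) (φ : F) :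
    ‖B x φ‖ ≤ ‖x‖ * ‖φ‖ := by
  rcases eq_or_ne φ 0 with rfl | hφ
  · simp
  have hn : 0 < ‖φ‖ := norm_pos_iff.2 hφ
  have h := (hB.norm_left x).1 (show ‖B x (((‖φ‖⁻¹ : ℝ) : ℂ) • φ)‖ ∈ _ from
    ⟨_, by rw [norm_smul]; simp [hn.ne'], rfl⟩)
  rw [map_smul, norm_smul, Complex.norm_real, norm_inv, norm_norm, inv_mul_eq_div,
    div_le_iff₀ hn] at h
  exact h

theorem IsDualPair.norm_le_of_forall {B : X →ₗ[ℂ] F →ₗ[ℂ] ℂ} (hB : IsDualPair B) {x : X} {M : ℝ}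
    (h : ∀ φ : F, ‖B x φ‖ ≤ M * ‖φ‖) (hM : 0 ≤ M) : ‖x‖ ≤ M := by
  refine (hB.norm_left x).2 ?_
  rintro r ⟨φ, hφ, rfl⟩
  exact (h φ).trans (mul_le_of_le_one_right hM hφ)

theorem IsDualPair.ext {B : X →ₗ[ℂ] F →ₗ[ℂ] ℂ} (hB : IsDualPair B) {x y : X}
    (h : ∀ φ : F, B x φ = B y φ) : x = y :=
  sub_eq_zero.1 (hB.eq_zero fun φ => by simp [h φ])

theorem isInducing_weakTopology (B : X →ₗ[ℂ] F →ₗ[ℂ] ℂ) :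
    @IsInducing X (F → ℂ) (weakTopology B) _ (fun (x : X) (φ : F) => B x φ) :=
  let _ := weakTopology B
  ⟨rfl⟩

theorem continuous_weakTopology_iff (B : X →ₗ[ℂ] F →ₗ[ℂ] ℂ) {α : Type*} [TopologicalSpace α]
    {f : α → X} :
    @Continuous α X _ (weakTopology B) f ↔ ∀ φ : F, Continuous (fun a => B (f a) φ) := by
  let _ := weakTopology B
  exact (isInducing_weakTopology B).continuous_iff.trans continuous_pi_iff

theorem continuous_pairing (B : X →ₗ[ℂ] F →ₗ[ℂ] ℂ) (φ : F) :
    @Continuous X ℂ (weakTopology B) _ (fun x => B x φ) := by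
  let _ := weakTopology B
  exact (continuous_weakTopology_iff B).1 continuous_id φ

/-- A family of vectors tending weakly to zero at infinity has a weak barycentre with respect to
any probability measure. -/
theorem KreinProperty.exists_barycentre {B : X →ₗ[ℂ] F →ₗ[ℂ] ℂ} (hK : KreinProperty B)
    {g : ℝ → X} (hg : ∀ φ, Continuous fun t => B (g t) φ)
    (hg0 : ∀ φ, Tendsto (fun t => B (g t) φ) (cocompact ℝ) (𝓝 0))
    (P : Measure ℝ) [IsProbabilityMeasure P] :
    ∃ y : X, ∀ φ, B y φ = ∫ t, B (g t) φ ∂P := by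
  let τ : TopologicalSpace X := weakTopology B
  have hcont : Continuous g := (continuous_weakTopology_iff B).2 hg
  have hlim : Tendsto g (cocompact ℝ) (𝓝 (0 : X)) := by
    rw [(isInducing_weakTopology B).tendsto_nhds_iff, tendsto_pi_nhds]
    simpa using hg0
  -- Since `g` tends weakly to `0` at infinity, adding the point `0` makes its range compact.
  set K : Set X := insert 0 (Set.range g) with hKdef
  have hKc : IsCompact K := hlim.isCompact_insert_range_of_cocompact hcont
  have hC : IsCompact (closure (convexHull ℝ K)) := hK K hKc
  have hint : ∀ φ, Integrable (fun t => B (g t) φ) P := by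
    intro φ
    have hb : IsCompact ((fun x => B x φ) '' K) := hKc.image (continuous_pairing B φ)
    obtain ⟨M, hM⟩ := hb.isBounded.exists_norm_le
    refine Integrable.of_bound (hg φ).aestronglyMeasurable M (Eventually.of_forall fun t => ?_)
    exact hM _ ⟨g t, Or.inr ⟨t, rfl⟩, rfl⟩
  -- Each condition on the barycentre is weakly closed, so by compactness finitely many `φ` suffice.
  -- The problem then lives in `ℂⁿ`, where the mean lies in the closed convex hull.
  obtain ⟨y, -, hy⟩ := hC.inter_iInter_nonempty
    (fun φ : F => {x : X | B x φ = ∫ t, B (g t) φ ∂P})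
    (fun φ => isClosed_eq (continuous_pairing B φ) continuous_const) (by
      intro u
      let Φ : X →ₗ[ℝ] (u → ℂ) := LinearMap.pi fun i =>
        ((B.flip i.1).restrictScalars ℝ)
      have hΦ : ∀ x i, Φ x i = B x i.1 := fun x i => rfl
      have hΦc : Continuous Φ := continuous_pi fun i => continuous_pairing B i.1
      have hcl : IsClosed (Φ '' closure (convexHull ℝ K)) := (hC.image hΦc).isClosed
      have hmem : ∫ t, Φ (g t) ∂P ∈ closure (convexHull ℝ (Φ '' K)) := by
        refine Convex.integral_mem (convex_convexHull ℝ _).closure isClosed_closure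
          (Eventually.of_forall fun t => subset_closure (subset_convexHull ℝ _
            ⟨g t, Or.inr ⟨t, rfl⟩, rfl⟩)) (Integrable.of_eval fun i => hint i.1)
      have hsub : closure (convexHull ℝ (Φ '' K)) ⊆ Φ '' closure (convexHull ℝ K) := by
        refine closure_minimal ?_ hcl
        rw [← LinearMap.image_convexHull]
        exact Set.image_mono subset_closure
      obtain ⟨x, hx, hxe⟩ := hsub hmem
      refine ⟨x, hx, Set.mem_iInter₂.2 fun φ hφ => ?_⟩
      have := congrFun hxe ⟨φ, hφ⟩
      rw [hΦ, eval_integral (f := fun t => Φ (g t)) fun i => hint i.1] at this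
      exact this)
  exact ⟨y, fun φ => Set.mem_iInter.1 hy φ⟩

/-- The weight `1 + t²` is, up to `π`, the reciprocal Cauchy density; it converts Lebesgue integrals
into means for a probability measure. -/
theorem tendsto_sq_mul_exp_neg_abs {δ : ℝ} (hδ : 0 < δ) :
    Tendsto (fun t : ℝ => (1 + t ^ 2) * Real.exp (-δ * |t|)) (cocompact ℝ) (𝓝 0) := by
  have h0 : Tendsto (fun s : ℝ => (1 + s ^ 2) * Real.exp (-δ * s)) atTop (𝓝 0) := by
    have a := (Real.tendsto_pow_mul_exp_neg_atTop_nhds_zero 0).comp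
      (tendsto_id.const_mul_atTop hδ)
    have b := ((Real.tendsto_pow_mul_exp_neg_atTop_nhds_zero 2).comp
      (tendsto_id.const_mul_atTop hδ)).const_mul ((δ ^ 2)⁻¹)
    have := a.add b
    simp only [mul_zero, add_zero] at this
    refine this.congr fun s => ?_
    simp only [Function.comp, id]
    field_simp
  have h2 : Tendsto (fun t : ℝ => |t|) (cocompact ℝ) atTop := tendsto_norm_cocompact_atTop
  refine (h0.comp h2).congr fun t => ?_
  simp

theorem integrable_exp_neg_mul_abs {δ : ℝ} (hδ : 0 < δ) :
    Integrable (fun t : ℝ => Real.exp (-δ * |t|)) := by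
  have hc : Continuous fun t : ℝ => (1 + t ^ 2) * Real.exp (-δ * |t|) := by fun_prop
  obtain ⟨M, hM⟩ := ((tendsto_sq_mul_exp_neg_abs hδ).isCompact_insert_range_of_cocompact
    hc).isBounded.exists_norm_le
  refine (integrable_inv_one_add_sq.const_mul M).mono' (by fun_prop) (Eventually.of_forall ?_)
  intro t
  have h := hM _ (Or.inr ⟨t, rfl⟩)
  have hp : (0 : ℝ) < 1 + t ^ 2 := by positivity
  rw [norm_mul, Real.norm_of_nonneg hp.le] at h
  rw [← div_eq_mul_inv, le_div_iff₀ hp, mul_comm]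
  exact h

theorem integrable_of_exp_bound {k : ℝ → ℂ} (hk : AEStronglyMeasurable k) {C δ : ℝ} (hδ : 0 < δ)
    (hb : ∀ t, ‖k t‖ ≤ C * Real.exp (-δ * |t|)) : Integrable k :=
  ((integrable_exp_neg_mul_abs hδ).const_mul C).mono' hk (Eventually.of_forall hb)

/-- Weak integrals of bounded weakly continuous functions against continuous, exponentially
decaying kernels exist. -/
theorem KreinProperty.exists_weakIntegral {B : X →ₗ[ℂ] F →ₗ[ℂ] ℂ} (hK : KreinProperty B)
    {k : ℝ → ℂ} (hk : Continuous k) {C δ : ℝ} (hδ : 0 < δ)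
    (hb : ∀ t, ‖k t‖ ≤ C * Real.exp (-δ * |t|))
    {v : ℝ → X} (hv : ∀ φ, Continuous fun t => B (v t) φ)
    (hvb : ∀ φ, ∃ M, ∀ t, ‖B (v t) φ‖ ≤ M) :
    ∃ y : X, ∀ φ, B y φ = ∫ t, k t * B (v t) φ := by
  -- The weight `π(1 + t²)` cancels the Cauchy density, and the decay of `k` still forces the
  -- weighted family to tend weakly to zero.
  obtain ⟨y, hy⟩ := hK.exists_barycentre
    (g := fun t => (((Real.pi * (1 + t ^ 2) : ℝ) : ℂ) * k t) • v t)
    (fun φ => by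
      simp only [map_smul, LinearMap.smul_apply, smul_eq_mul]
      exact (((by fun_prop : Continuous fun t : ℝ => ((Real.pi * (1 + t ^ 2) : ℝ) : ℂ)).mul
        hk).mul (hv φ)))
    (fun φ => by
      obtain ⟨M, hM⟩ := hvb φ
      have h := ((tendsto_sq_mul_exp_neg_abs hδ).const_mul (Real.pi * C * M))
      rw [mul_zero] at h
      refine squeeze_zero_norm (fun t => ?_) h
      simp only [map_smul, LinearMap.smul_apply, smul_eq_mul, norm_mul, Complex.norm_real]
      rw [Real.norm_of_nonneg Real.pi_pos.le,
        Real.norm_of_nonneg (by positivity : (0 : ℝ) ≤ 1 + t ^ 2)]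
      have h1 := mul_le_mul (hb t) (hM t) (norm_nonneg _) ((norm_nonneg _).trans (hb t))
      calc Real.pi * (1 + t ^ 2) * ‖k t‖ * ‖B (v t) φ‖
          = Real.pi * (1 + t ^ 2) * (‖k t‖ * ‖B (v t) φ‖) := by ring
        _ ≤ Real.pi * (1 + t ^ 2) * (C * Real.exp (-δ * |t|) * M) := by gcongr
        _ = _ := by ring)
    (cauchyMeasure 0 1)
  refine ⟨y, fun φ => ?_⟩
  rw [hy, cauchyMeasure_of_scale_ne_zero 0 one_ne_zero,
    integral_withDensity_eq_integral_toReal_smul (measurable_cauchyPDF 0 1)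
      (Eventually.of_forall fun t => by simp [cauchyPDF])]
  congr 1
  ext t
  have hp : (1 + t ^ 2 : ℝ) ≠ 0 := by positivity
  have hρ : (cauchyPDF 0 1 t).toReal = (Real.pi * (1 + t ^ 2))⁻¹ := by
    rw [cauchyPDF, ENNReal.toReal_ofReal (cauchyPDF_pos 0 one_ne_zero t).le, cauchyPDFReal_def']
    simp [mul_comm]
  rw [hρ]
  have hne : ((Real.pi * (1 + t ^ 2) : ℝ) : ℂ) ≠ 0 := by
    exact_mod_cast mul_ne_zero Real.pi_ne_zero hp
  rw [map_smul, LinearMap.smul_apply, smul_eq_mul, Complex.real_smul, Complex.ofReal_inv,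
    mul_assoc, inv_mul_cancel_left₀ hne]

/-- A weakly continuous operator has an adjoint with respect to the pairing. -/
theorem IsWeakContinuous.exists_adjoint {B : X →ₗ[ℂ] F →ₗ[ℂ] ℂ} {T : X →L[ℂ] X}
    (hT : IsWeakContinuous B T) (φ : F) : ∃ ψ : F, ∀ x, B (T x) φ = B x ψ := by
  have hc : @Continuous X ℂ (weakTopology B) _ (fun x => B (T x) φ) := by
    let _ := weakTopology B
    exact (continuous_weakTopology_iff B).1 hT φ
  -- Every `σ(X, F)`-continuous functional is the pairing with some element of `F`.
  let ℓ : StrongDual ℂ (WeakBilin B) :=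
    { toLinearMap := (B.flip φ).comp T.toLinearMap
      cont := hc }
  obtain ⟨ψ, hψ⟩ := LinearMap.dualEmbedding_surjective B ℓ
  refine ⟨ψ, fun x => ?_⟩
  exact (congrArg (fun m : StrongDual ℂ (WeakBilin B) => m x) hψ).symm

theorem isWeakContinuous_of_adjoint {B : X →ₗ[ℂ] F →ₗ[ℂ] ℂ} {T : X →L[ℂ] X}
    (h : ∀ φ : F, ∃ ψ : F, ∀ x, B (T x) φ = B x ψ) : IsWeakContinuous B T := by
  let _ := weakTopology B
  refine (continuous_weakTopology_iff B).2 fun φ => ?_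
  obtain ⟨ψ, hψ⟩ := h φ
  simp only [hψ]
  exact continuous_pairing B ψ

theorem IsIsometryGroup.continuous_pairing_orbit {B : X →ₗ[ℂ] F →ₗ[ℂ] ℂ} {U : ℝ → X →L[ℂ] X}
    (hU : IsIsometryGroup B U) (x : X) (φ : F) : Continuous fun t => B (U t x) φ :=
  (continuous_weakTopology_iff B).1 (hU.continuous_orbit x) φ

theorem IsIsometryGroup.norm_apply {B : X →ₗ[ℂ] F →ₗ[ℂ] ℂ} {U : ℝ → X →L[ℂ] X}
    (hU : IsIsometryGroup B U) (t : ℝ) (x : X) : ‖U t x‖ = ‖x‖ := by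
  simpa using (hU.isometry t).norm_map_of_map_zero (_root_.map_zero _) x

theorem IsIsometryGroup.norm_pairing_le {B : X →ₗ[ℂ] F →ₗ[ℂ] ℂ} {U : ℝ → X →L[ℂ] X}
    (hB : IsDualPair B) (hU : IsIsometryGroup B U) (t : ℝ) (x : X) (φ : F) :
    ‖B (U t x) φ‖ ≤ ‖x‖ * ‖φ‖ := by
  simpa [hU.norm_apply] using hB.norm_le_mul (U t x) φ

/-- The operator `∫ k(t) U_t dt` for a continuous, exponentially decaying kernel `k`. -/
theorem IsIsometryGroup.exists_integral_operator {B : X →ₗ[ℂ] F →ₗ[ℂ] ℂ} {U : ℝ → X →L[ℂ] X}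
    (hB : IsDualPair B) (hXF : KreinProperty B) (hFX : KreinProperty B.flip)
    (hU : IsIsometryGroup B U) {k : ℝ → ℂ} (hk : Continuous k) {C δ : ℝ} (hδ : 0 < δ)
    (hb : ∀ t, ‖k t‖ ≤ C * Real.exp (-δ * |t|)) :
    ∃ A : X →L[ℂ] X, IsWeakContinuous B A ∧
      ∀ x φ, Integrable (fun t => k t * B (U t x) φ) ∧
        B (A x) φ = ∫ t, k t * B (U t x) φ := by
  have hki : Integrable k := integrable_of_exp_bound hk.aestronglyMeasurable hδ hb
  have hint : ∀ x φ, Integrable (fun t => k t * B (U t x) φ) := fun x φ =>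
    hki.mul_bdd (hU.continuous_pairing_orbit x φ).aestronglyMeasurable
      (Eventually.of_forall fun t => hU.norm_pairing_le hB t x φ)
  choose A hA using fun x => hXF.exists_weakIntegral hk hδ hb (v := fun t => U t x)
    (hU.continuous_pairing_orbit x) (fun φ => ⟨_, fun t => hU.norm_pairing_le hB t x φ⟩)
  let A₀ : X →ₗ[ℂ] X :=
    { toFun := A
      map_add' := fun x y => hB.ext fun φ => by
        simp only [hA, _root_.map_add, LinearMap.add_apply, mul_add]
        exact integral_add (hint x φ) (hint y φ)
      map_smul' := fun c x => hB.ext fun φ => by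
        simp only [hA, map_smul, LinearMap.smul_apply, smul_eq_mul, RingHom.id_apply]
        rw [← integral_const_mul]
        congr 1
        ext t
        ring }
  have hbound : ∀ x, ‖A₀ x‖ ≤ (∫ t, ‖k t‖) * ‖x‖ := by
    intro x
    refine hB.norm_le_of_forall (fun φ => ?_)
      (mul_nonneg (integral_nonneg fun _ => norm_nonneg _) (norm_nonneg _))
    change ‖B (A x) φ‖ ≤ _
    rw [hA, mul_assoc, ← integral_mul_const]
    refine norm_integral_le_of_norm_le (hki.norm.mul_const _) (Eventually.of_forall fun t => ?_)
    rw [norm_mul]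
    exact mul_le_mul_of_nonneg_left (hU.norm_pairing_le hB t x φ) (norm_nonneg _)
  refine ⟨A₀.mkContinuous _ hbound, isWeakContinuous_of_adjoint fun φ => ?_,
    fun x φ => ⟨hint x φ, hA x φ⟩⟩
  -- The adjoint orbit of `φ` is continuous for `σ(F, X)`, so it can be integrated in `F`; its
  -- integral is the adjoint of the operator applied to `φ`.
  choose V hV using fun t => (hU.weakContinuous t).exists_adjoint φ
  obtain ⟨ψ, hψ⟩ := hFX.exists_weakIntegral hk hδ hb (v := V)
    (fun x => by
      simp only [LinearMap.flip_apply, ← hV]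
      exact hU.continuous_pairing_orbit x φ)
    (fun x => ⟨‖x‖ * ‖φ‖, fun t => by
      simp only [LinearMap.flip_apply, ← hV]
      exact hU.norm_pairing_le hB t x φ⟩)
  refine ⟨ψ, fun x => ?_⟩
  have h := hψ x
  simp only [LinearMap.flip_apply, ← hV] at h
  rw [h]
  exact hA x φ

end WeakIntegrals

/-! ### The kernel `E_μ`: holomorphy, functional equation and decay -/

section Kernel

/-- The entire function `z ↦ sinh (π z) / z`. -/
def sinhQuot (z : ℂ) : ℂ := dslope (fun w : ℂ => Complex.sinh (Real.pi * w)) 0 z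

/-- `E_μ(z) = z μ^(iz) / (e^(πz) - e^(-πz))`, with the singularity at `z = 0` removed. -/
def kernelE (μ z : ℂ) : ℂ := Complex.exp (Complex.I * z * Complex.log μ) / (2 * sinhQuot z)

theorem sinhQuot_of_ne {z : ℂ} (hz : z ≠ 0) :
    sinhQuot z = Complex.sinh (Real.pi * z) / z := by
  rw [sinhQuot, dslope_of_ne _ hz, slope_def_field]
  simp

theorem sinhQuot_zero : sinhQuot 0 = Real.pi := by
  have h : HasDerivAt (fun w : ℂ => Complex.sinh (Real.pi * w)) Real.pi 0 := by
    simpa using ((hasDerivAt_id (0 : ℂ)).const_mul (Real.pi : ℂ)).csinh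
  rw [sinhQuot, dslope_same, h.deriv]

theorem differentiable_sinhQuot : Differentiable ℂ sinhQuot := by
  rw [← differentiableOn_univ]
  exact (Complex.differentiableOn_dslope univ_mem).2 (by fun_prop)

theorem abs_sinh_re_le_norm (z : ℂ) : |Real.sinh z.re| ≤ ‖Complex.sinh z‖ := by
  have h := abs_norm_sub_norm_le (Complex.exp z) (Complex.exp (-z))
  rw [Complex.norm_exp, Complex.norm_exp, Complex.neg_re] at h
  rw [Complex.sinh, Real.sinh_eq, norm_div, abs_div]
  simpa using div_le_div_of_nonneg_right h (by norm_num : (0 : ℝ) ≤ 2)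

/-- The zeros of `sinh (πz)` are the points `i n` with `n` an integer. Only `0` lies in this strip,
and there the quotient takes the value `π`. -/
theorem sinhQuot_ne_zero {z : ℂ} (hz : |z.im| < 1) : sinhQuot z ≠ 0 := by
  rcases eq_or_ne z 0 with rfl | h0
  · rw [sinhQuot_zero]
    exact_mod_cast Real.pi_ne_zero
  rw [sinhQuot_of_ne h0]
  refine div_ne_zero (fun h => h0 ?_) h0
  have h1 := abs_sinh_re_le_norm (Real.pi * z)
  rw [h, norm_zero, Complex.re_ofReal_mul] at h1
  have h2 : z.re = 0 := by
    have := abs_nonpos_iff.1 h1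
    rw [Real.sinh_eq_zero] at this
    simpa [Real.pi_ne_zero] using this
  have h3 : z = z.im * Complex.I := Complex.ext (by simp [h2]) (by simp)
  rw [h3, ← mul_assoc, Complex.sinh_mul_I, mul_eq_zero_iff_right Complex.I_ne_zero] at h
  have h4 : Real.sin (Real.pi * z.im) = 0 := by exact_mod_cast h
  have h5 := abs_lt.1 hz
  rw [Real.sin_eq_zero_iff_of_lt_of_lt (by nlinarith [Real.pi_pos]) (by nlinarith [Real.pi_pos])]
    at h4
  have h6 : z.im = 0 := by simpa [Real.pi_ne_zero] using h4
  exact Complex.ext h2 h6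

theorem kernelE_of_ne (μ : ℂ) {z : ℂ} (hz : z ≠ 0) :
    kernelE μ z = Complex.exp (Complex.I * z * Complex.log μ) * z /
      (2 * Complex.sinh (Real.pi * z)) := by
  rw [kernelE, sinhQuot_of_ne hz, ← mul_div_assoc, div_div_eq_mul_div]

theorem kernelE_zero (μ : ℂ) : kernelE μ 0 = (2 * Real.pi : ℂ)⁻¹ := by
  rw [kernelE, sinhQuot_zero]
  simp

theorem differentiableAt_kernelE (μ : ℂ) {z : ℂ} (hz : |z.im| < 1) :
    DifferentiableAt ℂ (kernelE μ) z := by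
  refine DifferentiableAt.div (by fun_prop) ((differentiable_sinhQuot z).const_mul 2) ?_
  exact mul_ne_zero two_ne_zero (sinhQuot_ne_zero hz)

theorem continuous_kernelE_ofReal (μ : ℂ) : Continuous fun t : ℝ => kernelE μ t :=
  continuous_iff_continuousAt.2 fun t =>
    (differentiableAt_kernelE μ (by simp)).continuousAt.comp Complex.continuous_ofReal.continuousAt

theorem kernelF_eq {μ : ℂ} (hμ : μ ≠ 0) {t : ℝ} (ht : t ≠ 0) :
    kernelF μ t = μ⁻¹ * kernelE μ t := by
  rw [kernelF, kernelE_of_ne μ (by exact_mod_cast ht), Complex.cpow_sub _ _ hμ,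
    Complex.cpow_def_of_ne_zero hμ, Complex.cpow_one, Complex.sinh]
  ring_nf

/-- Under `z ↦ z - i` the exponential gains the factor `μ` and `sinh (πz)` changes sign. The linear
factor contributes the extra term `i E_μ(z)/z`, the only one with a pole at `0`. -/
theorem kernelE_sub_I {μ : ℂ} (hμ : μ ≠ 0) {z : ℂ} (hz : z ≠ 0) (hz' : z ≠ Complex.I) :
    kernelE μ (z - Complex.I) = μ * (-kernelE μ z + Complex.I * (kernelE μ z / z)) := by
  have h1 : Complex.exp (Complex.I * (z - Complex.I) * Complex.log μ) =
      μ * Complex.exp (Complex.I * z * Complex.log μ) := by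
    rw [show Complex.I * (z - Complex.I) * Complex.log μ =
      Complex.log μ + Complex.I * z * Complex.log μ by
        linear_combination (-Complex.log μ) * Complex.I_sq, Complex.exp_add, Complex.exp_log hμ]
  have h2 : Complex.sinh (Real.pi * (z - Complex.I)) = -Complex.sinh (Real.pi * z) := by
    rw [mul_sub, Complex.sinh_sub, Complex.cosh_mul_I, Complex.sinh_mul_I]
    simp
  rw [kernelE_of_ne μ (sub_ne_zero.2 hz'), kernelE_of_ne μ hz, h1, h2]
  field_simp
  ring

/-- `E_μ` decays exponentially on strips, at the rate `(π - |arg μ|) / 2`. -/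
theorem exists_kernelE_bound {μ : ℂ} (hμ : μ ∈ Complex.slitPlane) {ρ : ℝ} (hρ : ρ < 1) :
    ∃ C δ : ℝ, 0 < δ ∧ ∀ z : ℂ, |z.im| ≤ ρ → ‖kernelE μ z‖ ≤ C * Real.exp (-δ * |z.re|) := by
  -- The exponential and `sinh` together decay at rate `π - |arg μ|`; half of it is spent on
  -- absorbing the linear factor `z`.
  set δ : ℝ := (Real.pi - |μ.arg|) / 2 with hδ
  have harg : |μ.arg| < Real.pi := by
    refine lt_of_le_of_ne (Complex.abs_arg_le_pi μ) fun h => ?_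
    rcases eq_or_eq_neg_of_abs_eq h with h | h
    · exact (Complex.mem_slitPlane_iff_arg.1 hμ).1 h
    · exact (Complex.neg_pi_lt_arg μ).ne' h
  have hδ0 : 0 < δ := by rw [hδ]; linarith
  refine Exists.imp (fun C hC => ⟨δ, hδ0, hC⟩) ?_
  -- the central part
  have hK : IsCompact (Set.Icc (-1 : ℝ) 1 ×ℂ Set.Icc (-ρ) ρ) := isCompact_Icc.reProdIm isCompact_Icc
  have hKc : ContinuousOn (kernelE μ) (Set.Icc (-1 : ℝ) 1 ×ℂ Set.Icc (-ρ) ρ) := fun z hz =>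
    (differentiableAt_kernelE μ ((abs_le.2 hz.2).trans_lt hρ)).continuousAt.continuousWithinAt
  obtain ⟨M, hM⟩ := (hK.image_of_continuousOn hKc).isBounded.exists_norm_le
  set L : ℝ := |Real.log ‖μ‖|
  refine ⟨max (M * Real.exp δ) (4 * (1 + δ⁻¹) * Real.exp L), fun z hz => ?_⟩
  rcases le_total |z.re| 1 with h1 | h1
  · have hM1 := hM _ ⟨z, ⟨abs_le.1 h1, abs_le.1 hz⟩, rfl⟩
    have hM0 : 0 ≤ M := (norm_nonneg _).trans hM1
    calc ‖kernelE μ z‖ ≤ M := hM1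
      _ = M * Real.exp δ * Real.exp (-δ) := by rw [mul_assoc, ← Real.exp_add]; simp
      _ ≤ M * Real.exp δ * Real.exp (-δ * |z.re|) := by
          gcongr
          nlinarith
      _ ≤ _ := by gcongr; exact le_max_left _ _
  · have hz0 : z ≠ 0 := by
      rintro rfl
      simp at h1
      linarith
    have himz : |z.im| ≤ 1 := hz.trans hρ.le
    set s := |z.re|
    have e1 : ‖Complex.exp (Complex.I * z * Complex.log μ)‖ ≤
        Real.exp L * Real.exp (|μ.arg| * s) := by
      rw [Complex.norm_exp, ← Real.exp_add]
      refine Real.exp_le_exp.2 ?_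
      have : (Complex.I * z * Complex.log μ).re = -(z.im * Real.log ‖μ‖) - z.re * μ.arg := by
        simp [Complex.log_re, Complex.log_im]
      rw [this]
      have a1 : -(z.im * Real.log ‖μ‖) ≤ L := by
        refine (neg_le_abs _).trans ?_
        rw [abs_mul]
        exact mul_le_of_le_one_left (abs_nonneg _) himz
      have a2 : -(z.re * μ.arg) ≤ |μ.arg| * s := by
        refine (neg_le_abs _).trans ?_
        rw [abs_mul, mul_comm]
      linarith
    have e2 : ‖z‖ ≤ (1 + δ⁻¹) * Real.exp (δ * s) := by
      have b1 : ‖z‖ ≤ s + 1 := (Complex.norm_le_abs_re_add_abs_im z).trans (by gcongr)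
      have b2 := Real.add_one_le_exp (δ * s)
      have b3 : s = δ⁻¹ * (δ * s) := by field_simp
      have b4 : δ⁻¹ * (δ * s) ≤ δ⁻¹ * Real.exp (δ * s) := by
        gcongr
        linarith
      have b5 : 1 ≤ Real.exp (δ * s) := Real.one_le_exp (by positivity)
      linarith
    have e3 : Real.exp (Real.pi * s) / 4 ≤ ‖Complex.sinh (Real.pi * z)‖ := by
      refine le_trans ?_ (abs_sinh_re_le_norm _)
      rw [Complex.re_ofReal_mul, Real.abs_sinh, abs_mul, abs_of_pos Real.pi_pos, Real.sinh_eq]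
      have c1 : Real.exp (-(Real.pi * s)) ≤ 1 := Real.exp_le_one_iff.2 (by
        have := Real.pi_pos
        simp only [Left.neg_nonpos_iff]
        positivity)
      have c2 : Real.pi * s + 1 ≤ Real.exp (Real.pi * s) := Real.add_one_le_exp _
      have c3 : 3 ≤ Real.pi * s := by nlinarith [Real.pi_gt_three]
      change Real.exp (Real.pi * s) / 4 ≤ (Real.exp (Real.pi * s) - Real.exp (-(Real.pi * s))) / 2
      linarith
    rw [kernelE_of_ne μ hz0, norm_div, norm_mul, norm_mul, Complex.norm_ofNat]
    have hpos := Real.exp_pos (Real.pi * s)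
    rw [div_le_iff₀ (by linarith)]
    have hexp : Real.exp (|μ.arg| * s) * Real.exp (δ * s) =
        Real.exp (-δ * s) * Real.exp (Real.pi * s) := by
      rw [← Real.exp_add, ← Real.exp_add]
      congr 1
      rw [hδ]
      ring
    have hδi : 0 ≤ 1 + δ⁻¹ := by positivity
    calc _ ≤ (Real.exp L * Real.exp (|μ.arg| * s)) * ((1 + δ⁻¹) * Real.exp (δ * s)) := by gcongr
      _ = (1 + δ⁻¹) * Real.exp L * (Real.exp (|μ.arg| * s) * Real.exp (δ * s)) := by ring
      _ = 4 * (1 + δ⁻¹) * Real.exp L * Real.exp (-δ * s) * (Real.exp (Real.pi * s) / 4) := by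
          rw [hexp]; ring
      _ ≤ max (M * Real.exp δ) (4 * (1 + δ⁻¹) * Real.exp L) * Real.exp (-δ * s) *
          (2 * ‖Complex.sinh (Real.pi * z)‖) := by
          gcongr
          · exact le_max_right _ _
          · linarith

end Kernel

/-! ### Contour shifts and residues between horizontal lines -/

section Contours

theorem tendsto_vertical_integral {D : ℂ → ℂ} {a b : ℝ} (hab : a ≤ b)
    (hlim : Tendsto D (comap Complex.re (cocompact ℝ) ⊓ 𝓟 (Complex.im ⁻¹' Set.Icc a b)) (𝓝 0)) :
    Tendsto (fun R : ℝ => ∫ y : ℝ in a..b, D (R + y * Complex.I)) (cocompact ℝ) (𝓝 0) := by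
  rw [Metric.tendsto_nhds]
  intro ε hε
  have hε' : 0 < ε / (b - a + 1) := div_pos hε (by linarith)
  have h := Metric.tendsto_nhds.1 hlim _ hε'
  rw [eventually_inf_principal, eventually_comap] at h
  filter_upwards [h] with R hR
  rw [dist_zero_right]
  have h2 : ‖∫ y : ℝ in a..b, D (R + y * Complex.I)‖ ≤ ε / (b - a + 1) * |b - a| := by
    refine intervalIntegral.norm_integral_le_of_norm_le_const fun y hy => ?_
    rw [Set.uIoc_of_le hab] at hy
    have := hR (R + y * Complex.I) (by simp) (by simpa using ⟨hy.1.le, hy.2⟩)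
    rw [dist_zero_right] at this
    exact this.le
  refine h2.trans_lt ?_
  rw [abs_of_nonneg (by linarith), div_mul_eq_mul_div, div_lt_iff₀ (by linarith)]
  nlinarith

/-- Shift of a horizontal contour. -/
theorem integral_horizontal_sub_eq_zero {D : ℂ → ℂ} {a b : ℝ} (hab : a ≤ b)
    (hc : ContinuousOn D (Complex.im ⁻¹' Set.Icc a b))
    (hd : DifferentiableOn ℂ D (Complex.im ⁻¹' Set.Ioo a b))
    (hlim : Tendsto D (comap Complex.re (cocompact ℝ) ⊓ 𝓟 (Complex.im ⁻¹' Set.Icc a b)) (𝓝 0))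
    (hint : Integrable fun t : ℝ => D (t + a * Complex.I) - D (t + b * Complex.I)) :
    ∫ t : ℝ, (D (t + a * Complex.I) - D (t + b * Complex.I)) = 0 := by
  have h1 := intervalIntegral_tendsto_integral hint tendsto_neg_atTop_atBot tendsto_id
  refine tendsto_nhds_unique h1 ?_
  have hv := tendsto_vertical_integral hab hlim
  rw [cocompact_eq_atBot_atTop, tendsto_sup] at hv
  have h2 := ((hv.1.comp tendsto_neg_atTop_atBot).const_mul Complex.I).sub
    (hv.2.const_mul Complex.I)
  rw [mul_zero, sub_zero] at h2
  refine h2.congr' ?_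
  filter_upwards [eventually_ge_atTop 0] with R hR
  -- Cauchy's theorem on `[-R, R] × [a, b]`; the vertical sides vanish as `R → ∞`. Only the
  -- difference of the two horizontal integrands is assumed integrable, which accommodates `1/z`.
  have h3 := Complex.integral_boundary_rect_eq_zero_of_continuousOn_of_differentiableOn D
    (⟨-R, a⟩ : ℂ) (⟨R, b⟩ : ℂ)
    (hc.mono fun z hz => by simpa [Set.uIcc_of_le hab] using hz.2)
    (hd.mono fun z hz => by simpa [hab] using hz.2)
  have hline : ∀ c ∈ Set.Icc a b,
      IntervalIntegrable (fun t : ℝ => D (t + c * Complex.I)) volume (-R) R := fun c hc' =>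
    (hc.comp (by fun_prop) fun t _ => by simpa using hc').intervalIntegrable
  simp only [Complex.ofReal_neg, Function.comp, id, smul_eq_mul] at h3 ⊢
  rw [intervalIntegral.integral_sub (hline a ⟨le_rfl, hab⟩) (hline b ⟨hab, le_rfl⟩)]
  linear_combination -h3

theorem tendsto_re_strip_of_bound {V : ℂ → ℂ} {a b C δ : ℝ} (hδ : 0 < δ)
    (hV : ∀ z ∈ Complex.im ⁻¹' Set.Icc a b, ‖V z‖ ≤ C * Real.exp (-δ * |z.re|)) :
    Tendsto V (comap Complex.re (cocompact ℝ) ⊓ 𝓟 (Complex.im ⁻¹' Set.Icc a b)) (𝓝 0) := by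
  have h2 : Tendsto (fun t : ℝ => |t|) (cocompact ℝ) atTop := tendsto_norm_cocompact_atTop
  have h3 : Tendsto (fun t : ℝ => C * Real.exp (-δ * |t|)) (cocompact ℝ) (𝓝 0) := by
    have := (Real.tendsto_exp_neg_atTop_nhds_zero.comp (h2.const_mul_atTop hδ)).const_mul C
    simpa [Function.comp_def] using this
  refine squeeze_zero_norm' ?_ ((h3.comp tendsto_comap).mono_left inf_le_left)
  filter_upwards [mem_inf_of_right (mem_principal_self _)] with z hz using hV z hz

theorem integrable_horizontal {V : ℂ → ℂ} {a b c C δ : ℝ} (hδ : 0 < δ)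
    (hc : ContinuousOn V (Complex.im ⁻¹' Set.Icc a b))
    (hV : ∀ z ∈ Complex.im ⁻¹' Set.Icc a b, ‖V z‖ ≤ C * Real.exp (-δ * |z.re|))
    (hac : c ∈ Set.Icc a b) : Integrable fun t : ℝ => V (t + c * Complex.I) := by
  have hm : ∀ t : ℝ, (t + c * Complex.I : ℂ) ∈ Complex.im ⁻¹' Set.Icc a b := fun t => by
    simpa using hac
  refine integrable_of_exp_bound ?_ hδ (C := C) fun t => by simpa using hV _ (hm t)
  exact (hc.comp_continuous (by fun_prop) hm).aestronglyMeasurable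

theorem integrable_horizontal_div_sub {V : ℂ → ℂ} {a b c C δ : ℝ} (hδ : 0 < δ)
    (hc : ContinuousOn V (Complex.im ⁻¹' Set.Icc a b))
    (hV : ∀ z ∈ Complex.im ⁻¹' Set.Icc a b, ‖V z‖ ≤ C * Real.exp (-δ * |z.re|))
    (hac : c ∈ Set.Icc a b) {w : ℂ} (hcw : c ≠ w.im) :
    Integrable fun t : ℝ => V (t + c * Complex.I) / (t + c * Complex.I - w) := by
  have hcont : Continuous fun t : ℝ => (t + c * Complex.I - w : ℂ)⁻¹ :=
    Continuous.inv₀ (by fun_prop) fun t h => hcw (by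
      simpa [sub_eq_zero] using congrArg Complex.im h)
  simp only [div_eq_mul_inv]
  refine (integrable_horizontal hδ hc hV hac).mul_bdd (c := |c - w.im|⁻¹)
    hcont.aestronglyMeasurable (Eventually.of_forall fun t => ?_)
  rw [norm_inv]
  refine inv_anti₀ (abs_pos.2 (sub_ne_zero.2 hcw)) ?_
  simpa using Complex.abs_im_le_norm (t + c * Complex.I - w)

theorem integral_horizontal_eq {V : ℂ → ℂ} {a b C δ : ℝ} (hab : a ≤ b) (hδ : 0 < δ)
    (hc : ContinuousOn V (Complex.im ⁻¹' Set.Icc a b))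
    (hd : DifferentiableOn ℂ V (Complex.im ⁻¹' Set.Ioo a b))
    (hV : ∀ z ∈ Complex.im ⁻¹' Set.Icc a b, ‖V z‖ ≤ C * Real.exp (-δ * |z.re|)) :
    ∫ t : ℝ, V (t + a * Complex.I) = ∫ t : ℝ, V (t + b * Complex.I) := by
  have ha := integrable_horizontal hδ hc hV (Set.left_mem_Icc.2 hab)
  have hb := integrable_horizontal hδ hc hV (Set.right_mem_Icc.2 hab)
  have h := integral_horizontal_sub_eq_zero hab hc hd (tendsto_re_strip_of_bound hδ hV) (ha.sub hb)
  rwa [integral_sub ha hb, sub_eq_zero] at h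

theorem ofReal_add_mul_I_ne_zero (t : ℝ) {p : ℝ} (hp : p ≠ 0) : (t + p * Complex.I : ℂ) ≠ 0 := by
  intro h
  exact hp (by simpa using congrArg Complex.im h)

theorem integrable_inv_sq_add_sq {p : ℝ} (hp : p ≠ 0) :
    Integrable fun t : ℝ => (t ^ 2 + p ^ 2)⁻¹ := by
  refine ((integrable_inv_one_add_sq.comp_div hp).const_mul (p ^ 2)⁻¹).congr
    (Eventually.of_forall fun t => ?_)
  simp only
  rw [← mul_inv]
  congr 1
  field_simp
  ring

theorem integral_univ_inv_sq_add_sq {p : ℝ} (hp : 0 < p) :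
    ∫ t : ℝ, (t ^ 2 + p ^ 2)⁻¹ = Real.pi / p := by
  have h := Measure.integral_comp_div (fun t : ℝ => (1 + t ^ 2)⁻¹) p
  rw [integral_univ_inv_one_add_sq, abs_of_pos hp, smul_eq_mul] at h
  have h2 : ∫ t : ℝ, (t ^ 2 + p ^ 2)⁻¹ = ∫ t : ℝ, (p ^ 2)⁻¹ * (1 + (t / p) ^ 2)⁻¹ := by
    congr 1
    ext t
    rw [← mul_inv]
    congr 1
    field_simp
    ring
  rw [h2, integral_const_mul, h]
  field_simp

theorem norm_inv_ofReal_add_mul_I_sq (t p : ℝ) :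
    ‖(t + p * Complex.I : ℂ)⁻¹‖ ^ 2 = (t ^ 2 + p ^ 2)⁻¹ := by
  rw [norm_inv, inv_pow, Complex.sq_norm, Complex.normSq_add_mul_I]

/-- The difference is `(q - p) i` times a product of two reciprocals, each square integrable;
neither reciprocal alone is integrable. -/
theorem integrable_inv_sub_inv {p q : ℝ} (hp : p ≠ 0) (hq : q ≠ 0) :
    Integrable fun t : ℝ => (t + p * Complex.I : ℂ)⁻¹ - (t + q * Complex.I : ℂ)⁻¹ := by
  have hcont : ∀ r : ℝ, r ≠ 0 → Continuous fun t : ℝ => (t + r * Complex.I : ℂ)⁻¹ := fun r hr =>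
    Continuous.inv₀ (by fun_prop) fun t => ofReal_add_mul_I_ne_zero t hr
  refine (((integrable_inv_sq_add_sq hp).add (integrable_inv_sq_add_sq hq)).const_mul
    |q - p|).mono' ((hcont p hp).sub (hcont q hq)).aestronglyMeasurable
    (Eventually.of_forall fun t => ?_)
  rw [inv_sub_inv (ofReal_add_mul_I_ne_zero t hp) (ofReal_add_mul_I_ne_zero t hq),
    show (t + q * Complex.I - (t + p * Complex.I) : ℂ) = ((q - p : ℝ) : ℂ) * Complex.I by
      push_cast; ring, norm_div, norm_mul, Complex.norm_I, mul_one, Complex.norm_real,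
    Real.norm_eq_abs, div_eq_mul_inv, norm_mul, mul_inv, ← norm_inv, ← norm_inv]
  refine mul_le_mul_of_nonneg_left ?_ (abs_nonneg _)
  simp only [Pi.add_apply]
  rw [← norm_inv_ofReal_add_mul_I_sq t p, ← norm_inv_ofReal_add_mul_I_sq t q]
  nlinarith [sq_nonneg (‖(t + p * Complex.I : ℂ)⁻¹‖ - ‖(t + q * Complex.I : ℂ)⁻¹‖),
    sq_nonneg (‖(t + p * Complex.I : ℂ)⁻¹‖ + ‖(t + q * Complex.I : ℂ)⁻¹‖)]

theorem tendsto_inv_sub_re_strip (w : ℂ) (S : Set ℂ) :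
    Tendsto (fun z : ℂ => (z - w)⁻¹) (comap Complex.re (cocompact ℝ) ⊓ 𝓟 S) (𝓝 0) := by
  have h2 : Tendsto (fun t : ℝ => |t|) (cocompact ℝ) atTop := tendsto_norm_cocompact_atTop
  have h : Tendsto (fun z : ℂ => ‖z - w‖) (comap Complex.re (cocompact ℝ)) atTop := by
    refine tendsto_atTop_mono (fun z => ?_)
      (tendsto_atTop_add_const_right _ (-|w.re|) (h2.comp tendsto_comap))
    have h1 := Complex.abs_re_le_norm (z - w)
    rw [Complex.sub_re] at h1
    have h3 := abs_sub_abs_le_abs_sub z.re w.re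
    simp only [Function.comp]
    linarith
  rw [tendsto_zero_iff_norm_tendsto_zero]
  simp only [norm_inv]
  exact (tendsto_inv_atTop_zero.comp h).mono_left inf_le_left

theorem integral_inv_sub_inv_of_pos {p q : ℝ} (hp : 0 < p) (hpq : p ≤ q) :
    ∫ t : ℝ, ((t + p * Complex.I : ℂ)⁻¹ - (t + q * Complex.I : ℂ)⁻¹) = 0 := by
  have hne : ∀ z : ℂ, z.im ∈ Set.Icc p q → z ≠ 0 := by
    rintro z hz rfl
    exact hp.not_ge hz.1
  refine integral_horizontal_sub_eq_zero (D := fun z => z⁻¹) hpq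
    (continuousOn_id.inv₀ fun z hz => hne z hz)
    (fun z hz => (differentiableAt_inv
      (hne z ⟨hz.1.le, hz.2.le⟩)).differentiableWithinAt) ?_
    (integrable_inv_sub_inv hp.ne' (hp.trans_le hpq).ne')
  simpa using tendsto_inv_sub_re_strip 0 _

/-- On the symmetric lines `Im z = ±p` the difference is a multiple of the Poisson kernel. Moving
the upper line from `p` to `q` crosses no pole. -/
theorem integral_inv_sub_inv {p q : ℝ} (hp : 0 < p) (hq : 0 < q) :
    ∫ t : ℝ, ((t - p * Complex.I : ℂ)⁻¹ - (t + q * Complex.I : ℂ)⁻¹) =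
      2 * Real.pi * Complex.I := by
  have h1 : ∫ t : ℝ, ((t - p * Complex.I : ℂ)⁻¹ - (t + p * Complex.I : ℂ)⁻¹) =
      2 * Real.pi * Complex.I := by
    have e : ∀ t : ℝ, (t - p * Complex.I : ℂ)⁻¹ - (t + p * Complex.I : ℂ)⁻¹ =
        (((t ^ 2 + p ^ 2)⁻¹ : ℝ) : ℂ) * (2 * p * Complex.I) := by
      intro t
      have h1 := ofReal_add_mul_I_ne_zero t hp.ne'
      have h2 : (t - p * Complex.I : ℂ) ≠ 0 := by
        simpa [sub_eq_add_neg] using ofReal_add_mul_I_ne_zero t (neg_ne_zero.2 hp.ne')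
      have h3 : (((t ^ 2 + p ^ 2 : ℝ)) : ℂ) = (t - p * Complex.I) * (t + p * Complex.I) := by
        push_cast
        linear_combination (p : ℂ) ^ 2 * (Complex.I_sq)
      rw [Complex.ofReal_inv, h3]
      field_simp
      ring
    simp only [e]
    rw [integral_mul_const, integral_complex_ofReal, integral_univ_inv_sq_add_sq hp]
    have : (p : ℂ) ≠ 0 := by exact_mod_cast hp.ne'
    push_cast
    field_simp
  have h2 : ∫ t : ℝ, ((t + p * Complex.I : ℂ)⁻¹ - (t + q * Complex.I : ℂ)⁻¹) = 0 := by
    rcases le_total p q with h | h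
    · exact integral_inv_sub_inv_of_pos hp h
    · have := integral_inv_sub_inv_of_pos hq h
      rw [← neg_eq_zero, ← integral_neg]
      simpa using this
  have i1 := integrable_inv_sub_inv (neg_ne_zero.2 hp.ne') hp.ne'
  have i2 := integrable_inv_sub_inv hp.ne' hq.ne'
  simp only [Complex.ofReal_neg, neg_mul, ← sub_eq_add_neg] at i1
  rw [← h1, ← add_zero (∫ t : ℝ, ((t - p * Complex.I : ℂ)⁻¹ - (t + p * Complex.I : ℂ)⁻¹)), ← h2,
    ← integral_add i1 i2]
  simp

/-- The residue theorem for a simple pole between two horizontal lines. -/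
theorem integral_div_sub_horizontal {V : ℂ → ℂ} {a b C δ : ℝ} (hδ : 0 < δ)
    (hc : ContinuousOn V (Complex.im ⁻¹' Set.Icc a b))
    (hd : DifferentiableOn ℂ V (Complex.im ⁻¹' Set.Ioo a b))
    (hV : ∀ z ∈ Complex.im ⁻¹' Set.Icc a b, ‖V z‖ ≤ C * Real.exp (-δ * |z.re|))
    {w : ℂ} (hw : w.im ∈ Set.Ioo a b) :
    ∫ t : ℝ, (V (t + a * Complex.I) / (t + a * Complex.I - w) -
      V (t + b * Complex.I) / (t + b * Complex.I - w)) = 2 * Real.pi * Complex.I * V w := by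
  have hab : a ≤ b := (hw.1.trans hw.2).le
  have hO : IsOpen (Complex.im ⁻¹' Set.Ioo a b) := isOpen_Ioo.preimage Complex.continuous_im
  have hnO : Complex.im ⁻¹' Set.Ioo a b ∈ 𝓝 w := hO.mem_nhds hw
  have hsub : Complex.im ⁻¹' Set.Ioo a b ⊆ Complex.im ⁻¹' Set.Icc a b :=
    Set.preimage_mono Set.Ioo_subset_Icc_self
  have hlineshift : ∀ c : ℝ, ∀ t : ℝ, (t + c * Complex.I - w : ℂ) =
      ((t - w.re : ℝ) : ℂ) + ((c - w.im : ℝ) : ℂ) * Complex.I := by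
    intro c t
    apply Complex.ext <;> simp
  have hne : ∀ c : ℝ, c ≠ w.im → ∀ t : ℝ, (t + c * Complex.I : ℂ) ≠ w := by
    intro c hcw t h
    exact hcw (by simpa using congrArg Complex.im h)
  have hds : ∀ c : ℝ, c ≠ w.im → ∀ t : ℝ, dslope V w (t + c * Complex.I) =
      V (t + c * Complex.I) / (t + c * Complex.I - w) - V w * (t + c * Complex.I - w)⁻¹ := by
    intro c hcw t
    rw [dslope_of_ne _ (hne c hcw t), slope_def_field]
    ring
  have hVint : ∀ c ∈ Set.Icc a b, c ≠ w.im →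
      Integrable fun t : ℝ => V (t + c * Complex.I) / (t + c * Complex.I - w) :=
    fun c hcm hcw => integrable_horizontal_div_sub hδ hc hV hcm hcw
  have ha : a ≠ w.im := hw.1.ne
  have hb : b ≠ w.im := hw.2.ne'
  have iV : Integrable fun t : ℝ => V (t + a * Complex.I) / (t + a * Complex.I - w) -
      V (t + b * Complex.I) / (t + b * Complex.I - w) :=
    (hVint a (Set.left_mem_Icc.2 hab) ha).sub (hVint b (Set.right_mem_Icc.2 hab) hb)
  have i0 : Integrable fun t : ℝ =>
      ((t + a * Complex.I - w : ℂ)⁻¹ - (t + b * Complex.I - w : ℂ)⁻¹) := by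
    simp only [hlineshift]
    exact (integrable_inv_sub_inv (sub_ne_zero.2 ha) (sub_ne_zero.2 hb)).comp_sub_right w.re
  have v0 : ∫ t : ℝ, ((t + a * Complex.I - w : ℂ)⁻¹ - (t + b * Complex.I - w : ℂ)⁻¹) =
      2 * Real.pi * Complex.I := by
    simp only [hlineshift]
    rw [integral_sub_right_eq_self (fun s : ℝ => ((s : ℂ) + ((a - w.im : ℝ) : ℂ) * Complex.I)⁻¹ -
      ((s : ℂ) + ((b - w.im : ℝ) : ℂ) * Complex.I)⁻¹) w.re,
      ← integral_inv_sub_inv (sub_pos.2 hw.1) (sub_pos.2 hw.2)]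
    congr 1
    ext t
    push_cast
    ring
  have hdd : ∀ t : ℝ, dslope V w (t + a * Complex.I) - dslope V w (t + b * Complex.I) =
      (V (t + a * Complex.I) / (t + a * Complex.I - w) -
        V (t + b * Complex.I) / (t + b * Complex.I - w)) -
      V w * ((t + a * Complex.I - w : ℂ)⁻¹ - (t + b * Complex.I - w : ℂ)⁻¹) := by
    intro t
    rw [hds a ha, hds b hb]
    ring
  -- The function `(V z - V w)/(z - w)` has no pole, so its two line integrals cancel; the residue
  -- comes entirely from `V w/(z - w)`.
  have key := integral_horizontal_sub_eq_zero (D := dslope V w) hab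
    ((continuousOn_dslope (mem_of_superset hnO hsub)).2
      ⟨hc, hd.differentiableAt hnO⟩)
    ((Complex.differentiableOn_dslope hnO).2 hd) (by
      have hz := (tendsto_re_strip_of_bound hδ hV).sub_const (V w)
      have := hz.mul (tendsto_inv_sub_re_strip w (Complex.im ⁻¹' Set.Icc a b))
      rw [mul_zero] at this
      refine this.congr' ?_
      have hev : ∀ᶠ z in comap Complex.re (cocompact ℝ) ⊓ 𝓟 (Complex.im ⁻¹' Set.Icc a b),
          z ≠ w := by
        refine mem_inf_of_left ?_
        refine mem_comap.2 ⟨{w.re}ᶜ, isCompact_singleton.compl_mem_cocompact, ?_⟩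
        rintro z hz rfl
        exact hz rfl
      filter_upwards [hev] with z hzw
      rw [dslope_of_ne _ hzw, slope_def_field, div_eq_mul_inv]) (by
      simp only [hdd]
      exact iV.sub (i0.const_mul _))
  simp only [hdd] at key
  rw [integral_sub iV (i0.const_mul _), integral_const_mul, v0, sub_eq_zero] at key
  rw [key]
  ring

end Contours

/-! ### Holomorphic dependence of integrals on a complex translation -/

section ParametricIntegral

/-- `k` is holomorphic on the open strip `a < Im z < b` and decays exponentially, uniformly on
smaller closed strips. -/
structure IsStripKernel (k : ℂ → ℂ) (a b : ℝ) : Prop where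
  differentiableOn : DifferentiableOn ℂ k (Complex.im ⁻¹' Set.Ioo a b)
  bound : ∀ c d : ℝ, a < c → d < b →
    ∃ C δ : ℝ, 0 < δ ∧ ∀ z ∈ Complex.im ⁻¹' Set.Icc c d, ‖k z‖ ≤ C * Real.exp (-δ * |z.re|)

theorem IsStripKernel.continuous_line {k : ℂ → ℂ} {a b : ℝ} (hk : IsStripKernel k a b) {w : ℂ}
    (hw : w.im ∈ Set.Ioo a b) : Continuous fun t : ℝ => k (t + w) :=
  hk.differentiableOn.continuousOn.comp_continuous (by fun_prop) fun t => by simpa using hw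

theorem exp_neg_mul_abs_add_le {δ : ℝ} (hδ : 0 < δ) {t s r : ℝ} (hs : |s| ≤ r) :
    Real.exp (-δ * |t + s|) ≤ Real.exp (δ * r) * Real.exp (-δ * |t|) := by
  rw [← Real.exp_add]
  refine Real.exp_le_exp.2 ?_
  have h : |t| ≤ |t + s| + r := by
    have := abs_sub (t + s) s
    rw [add_sub_cancel_right] at this
    linarith
  nlinarith

/-- One exponential bound serves a whole disc of translations, as needed for domination when
differentiating under the integral. -/
theorem IsStripKernel.bound_line {k : ℂ → ℂ} {a b : ℝ} (hk : IsStripKernel k a b) {w : ℂ}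
    (hw : w.im ∈ Set.Ioo a b) :
    ∃ r > 0, ∃ C δ : ℝ, 0 < δ ∧ ∀ z ∈ Metric.closedBall w r, z.im ∈ Set.Ioo a b ∧
      ∀ t : ℝ, ‖k (t + z)‖ ≤ C * Real.exp (-δ * |t|) := by
  obtain ⟨c, hac, hcw⟩ := exists_between hw.1
  obtain ⟨d, hwd, hdb⟩ := exists_between hw.2
  obtain ⟨C, δ, hδ, hb⟩ := hk.bound c d hac hdb
  have hC : 0 ≤ C := by
    have h := (norm_nonneg _).trans (hb w ⟨hcw.le, hwd.le⟩)
    exact nonneg_of_mul_nonneg_left h (Real.exp_pos _)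
  have hr : 0 < min (w.im - c) (d - w.im) := lt_min (by linarith) (by linarith)
  refine ⟨_, hr, C * Real.exp (δ * (|w.re| + min (w.im - c) (d - w.im))), δ, hδ,
    fun z hz => ?_⟩
  rw [mem_closedBall_iff_norm] at hz
  have him : |z.im - w.im| ≤ min (w.im - c) (d - w.im) := by
    simpa using (Complex.abs_im_le_norm (z - w)).trans hz
  have hre : |z.re| ≤ |w.re| + min (w.im - c) (d - w.im) := by
    have h1 : |z.re - w.re| ≤ min (w.im - c) (d - w.im) := by
      simpa using (Complex.abs_re_le_norm (z - w)).trans hz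
    have h2 := abs_sub_abs_le_abs_sub z.re w.re
    linarith
  have h1 := abs_le.1 (him.trans (min_le_left _ _))
  have h2 := abs_le.1 (him.trans (min_le_right _ _))
  have hzc : z.im ∈ Set.Icc c d := ⟨by linarith, by linarith⟩
  refine ⟨⟨hac.trans_le hzc.1, hzc.2.trans_lt hdb⟩, fun t => ?_⟩
  have h3 := hb (t + z) (by simpa using hzc)
  refine h3.trans ?_
  rw [mul_assoc]
  refine mul_le_mul_of_nonneg_left ?_ hC
  simpa using exp_neg_mul_abs_add_le hδ (t := t) hre

theorem IsStripKernel.integrable_mul {k : ℂ → ℂ} {a b : ℝ} (hk : IsStripKernel k a b) {w : ℂ}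
    (hw : w.im ∈ Set.Ioo a b) {u : ℝ → ℂ} (hu : Continuous u) {M : ℝ} (hM : ∀ t, ‖u t‖ ≤ M) :
    Integrable fun t : ℝ => k (t + w) * u t := by
  obtain ⟨r, hr, C, δ, hδ, hb⟩ := hk.bound_line hw
  exact (integrable_of_exp_bound (hk.continuous_line hw).aestronglyMeasurable hδ
    (hb w (Metric.mem_closedBall_self hr.le)).2).mul_bdd hu.aestronglyMeasurable
    (Eventually.of_forall hM)

theorem IsStripKernel.differentiableOn_integral {k : ℂ → ℂ} {a b : ℝ} (hk : IsStripKernel k a b)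
    {u : ℝ → ℂ} (hu : Continuous u) {M : ℝ} (hM : ∀ t, ‖u t‖ ≤ M) :
    DifferentiableOn ℂ (fun w : ℂ => ∫ t : ℝ, k (t + w) * u t) (Complex.im ⁻¹' Set.Ioo a b) := by
  intro w hw
  have hO : IsOpen (Complex.im ⁻¹' Set.Ioo a b) := isOpen_Ioo.preimage Complex.continuous_im
  obtain ⟨r, hr, C, δ, hδ, hb⟩ := hk.bound_line hw
  have hr2 : 0 < r / 2 := half_pos hr
  have hM0 : 0 ≤ M := (norm_nonneg _).trans (hM 0)
  have hkd : ∀ z : ℂ, z.im ∈ Set.Ioo a b → ∀ t : ℝ, DifferentiableAt ℂ k (t + z) := fun z hz t =>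
    hk.differentiableOn.differentiableAt (hO.mem_nhds (by simpa using hz))
  refine (hasDerivAt_integral_of_dominated_loc_of_deriv_le
    (F' := fun z t => deriv k (t + z) * u t) (s := Metric.ball w (r / 2))
    (bound := fun t => C * Real.exp (-δ * |t|) / (r / 2) * M)
    (Metric.ball_mem_nhds w hr2) ?_ (hk.integrable_mul hw hu hM) ?_ ?_ ?_
    ?_).2.differentiableAt.differentiableWithinAt
  · filter_upwards [hO.mem_nhds hw] with z hz
    exact ((hk.continuous_line hz).mul hu).aestronglyMeasurable
  · have h1 := (hk.differentiableOn.deriv hO).continuousOn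
    exact ((h1.comp_continuous (f := fun t : ℝ => (t + w : ℂ)) (by fun_prop)
      fun t => by simpa using hw).mul hu).aestronglyMeasurable
  · refine Eventually.of_forall fun t z hz => ?_
    rw [norm_mul]
    refine mul_le_mul ?_ (hM t) (norm_nonneg _) ?_
    · have hball : ∀ y ∈ Metric.closedBall (t + z : ℂ) (r / 2), y - t ∈ Metric.closedBall w r := by
        intro y hy
        rw [Metric.mem_ball, dist_eq_norm] at hz
        rw [Metric.mem_closedBall, dist_eq_norm] at hy ⊢
        calc ‖y - t - w‖ = ‖(y - (t + z)) + (z - w)‖ := by congr 1; ring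
          _ ≤ r / 2 + r / 2 := (norm_add_le _ _).trans (add_le_add hy hz.le)
          _ = r := by ring
      -- Cauchy's estimate on a circle of radius `r / 2` bounds the derivative. The other half of
      -- `r` leaves room for `z` to vary, so the circle stays where `k` is controlled.
      refine Complex.norm_deriv_le_of_forall_mem_sphere_norm_le hr2 ?_ fun y hy => ?_
      · refine DifferentiableOn.diffContOnCl fun y hy => ?_
        have := hkd _ (hb _ (hball y (Metric.closure_ball_subset_closedBall hy))).1 t
        rw [add_sub_cancel] at this
        exact this.differentiableWithinAt
      · have := (hb _ (hball y (Metric.sphere_subset_closedBall hy))).2 t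
        rwa [add_sub_cancel] at this
    · have := (norm_nonneg _).trans ((hb w (Metric.mem_closedBall_self hr.le)).2 t)
      positivity
  · exact (((integrable_exp_neg_mul_abs hδ).const_mul C).div_const _).mul_const _
  · refine Eventually.of_forall fun t z hz => ?_
    have hz' := (hb z (Metric.closedBall_subset_closedBall (by linarith)
      (Metric.ball_subset_closedBall hz))).1
    have h1 := (hkd z hz' t).hasDerivAt
    exact (h1.comp_const_add (t : ℂ) z).mul_const (u t)

end ParametricIntegral

/-! ### The scalar contour identities behind `T Q T = T - 2μ Q T - μ² Q` -/

section ScalarIdentities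

/-- A bounded continuous function on the closed unit strip, holomorphic inside. -/
structure IsUnitStripFunction (u : ℂ → ℂ) (M : ℝ) : Prop where
  continuousOn : ContinuousOn u (Complex.im ⁻¹' Set.Icc 0 1)
  differentiableOn : DifferentiableOn ℂ u (Complex.im ⁻¹' Set.Ioo 0 1)
  bound : ∀ z ∈ Complex.im ⁻¹' Set.Icc 0 1, ‖u z‖ ≤ M

theorem IsUnitStripFunction.continuous_line {u : ℂ → ℂ} {M : ℝ} (hu : IsUnitStripFunction u M)
    {a : ℝ} (ha : a ∈ Set.Icc (0 : ℝ) 1) : Continuous fun t : ℝ => u (t + a * Complex.I) :=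
  hu.continuousOn.comp_continuous (by fun_prop) fun t => by simpa using ha

theorem IsUnitStripFunction.bound_line {u : ℂ → ℂ} {M : ℝ} (hu : IsUnitStripFunction u M)
    {a : ℝ} (ha : a ∈ Set.Icc (0 : ℝ) 1) (t : ℝ) : ‖u (t + a * Complex.I)‖ ≤ M :=
  hu.bound _ (by simpa using ha)

theorem isStripKernel_kernelE {μ : ℂ} (hμ : μ ∈ Complex.slitPlane) :
    IsStripKernel (kernelE μ) (-1) 1 where
  differentiableOn z hz :=
    (differentiableAt_kernelE μ (abs_lt.2 hz)).differentiableWithinAt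
  bound c d hc hd := by
    obtain ⟨C, δ, hδ, h⟩ := exists_kernelE_bound hμ (ρ := max (-c) d) (max_lt (by linarith) hd)
    refine ⟨C, δ, hδ, fun z hz => h z (abs_le.2 ⟨?_, hz.2.trans (le_max_right _ _)⟩)⟩
    have := le_max_left (-c) d
    linarith [hz.1]

/-- The kernel `μ⁻¹ E_μ(z - i)`, continued across the real axis. -/
def shiftedKernel (μ z : ℂ) : ℂ := -kernelE μ z + Complex.I * (kernelE μ z / z)

theorem isStripKernel_shiftedKernel {μ : ℂ} (hμ : μ ∈ Complex.slitPlane) :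
    IsStripKernel (shiftedKernel μ) (-1) 0 where
  differentiableOn z hz := by
    have h0 : z ≠ 0 := by
      rintro rfl
      exact lt_irrefl _ hz.2
    have h1 := differentiableAt_kernelE μ (z := z) (abs_lt.2 ⟨hz.1, hz.2.trans one_pos⟩)
    exact (h1.neg.add ((h1.div differentiableAt_id h0).const_mul _)).differentiableWithinAt
  bound c d hc hd := by
    obtain ⟨C, δ, hδ, h⟩ := (isStripKernel_kernelE hμ).bound c d hc (hd.trans one_pos)
    refine ⟨(1 + (-d)⁻¹) * C, δ, hδ, fun z hz => ?_⟩
    have hd' : 0 < -d := by linarith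
    have hz1 : -d ≤ ‖z‖ := by
      have := (neg_le_abs z.im).trans (Complex.abs_im_le_norm z)
      linarith [hz.2]
    have hinv : ‖z‖⁻¹ ≤ (-d)⁻¹ := inv_anti₀ hd' hz1
    calc ‖shiftedKernel μ z‖ ≤ ‖kernelE μ z‖ + ‖kernelE μ z‖ * ‖z‖⁻¹ := by
          refine (norm_add_le _ _).trans ?_
          rw [norm_neg, norm_mul, Complex.norm_I, one_mul, norm_div, div_eq_mul_inv]
      _ = (1 + ‖z‖⁻¹) * ‖kernelE μ z‖ := by ring
      _ ≤ (1 + (-d)⁻¹) * (C * Real.exp (-δ * |z.re|)) := by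
          gcongr
          exact h z hz
      _ = _ := by ring

theorem kernelE_sub_I_eq_shiftedKernel {μ : ℂ} (hμ : μ ≠ 0) {z : ℂ} (hz : z.im ∈ Set.Ioo 0 1) :
    kernelE μ (z - Complex.I) = μ * shiftedKernel μ z := by
  refine kernelE_sub_I hμ ?_ ?_
  · rintro rfl
    exact lt_irrefl _ hz.1
  · rintro rfl
    simp at hz

/-- The functional equation at `z + i` eliminates `E_μ(z)/z`. Neither remaining term has a pole at
`0`, so their contours can be moved separately. -/
theorem shiftedKernel_eq {μ : ℂ} (hμ : μ ≠ 0) {z : ℂ} (hz : z.im ∈ Set.Ioo (-1) 0) :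
    shiftedKernel μ z = -2 * kernelE μ z - μ * kernelE μ (z + Complex.I) := by
  have h0 : z ≠ 0 := by
    rintro rfl
    exact lt_irrefl _ hz.2
  have h1 : z + Complex.I ≠ 0 := by
    intro h
    have := congrArg Complex.im h
    simp at this
    linarith [hz.1]
  have h := kernelE_sub_I hμ h1 (by simpa using h0)
  rw [add_sub_cancel_right] at h
  rw [shiftedKernel, h]
  field_simp
  ring

/-- The bounds on `a` and `b` keep `|Im (z - w)| < 1`, away from the poles of `E_μ`; the product
then qualifies for the contour lemmas. -/
theorem kernelE_mul_strip {μ : ℂ} (hμ : μ ∈ Complex.slitPlane) {u : ℂ → ℂ} {M : ℝ}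
    (hu : IsUnitStripFunction u M) {a b : ℝ} (ha : 0 ≤ a) (hb : b ≤ 1) {w : ℂ}
    (haw : w.im - 1 < a) (hbw : b < w.im + 1) :
    ContinuousOn (fun z => kernelE μ (z - w) * u z) (Complex.im ⁻¹' Set.Icc a b) ∧
    DifferentiableOn ℂ (fun z => kernelE μ (z - w) * u z) (Complex.im ⁻¹' Set.Ioo a b) ∧
    ∃ C δ : ℝ, 0 < δ ∧ ∀ z ∈ Complex.im ⁻¹' Set.Icc a b,
      ‖kernelE μ (z - w) * u z‖ ≤ C * Real.exp (-δ * |z.re|) := by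
  have hd : ∀ z ∈ Complex.im ⁻¹' Set.Icc a b,
      DifferentiableAt ℂ (fun z => kernelE μ (z - w)) z := by
    intro z hz
    have hz1 : |(z - w).im| < 1 := by
      rw [Complex.sub_im, abs_lt]
      constructor <;> linarith [hz.1, hz.2]
    exact DifferentiableAt.fun_comp' z (differentiableAt_kernelE μ hz1)
      (differentiableAt_id.sub_const w)
  have hIcc : Complex.im ⁻¹' Set.Icc a b ⊆ Complex.im ⁻¹' Set.Icc 0 1 :=
    Set.preimage_mono (Set.Icc_subset_Icc ha hb)
  have hIoo : Complex.im ⁻¹' Set.Ioo a b ⊆ Complex.im ⁻¹' Set.Ioo 0 1 :=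
    Set.preimage_mono (Set.Ioo_subset_Ioo ha hb)
  refine ⟨ContinuousOn.mul (fun z hz => (hd z hz).continuousAt.continuousWithinAt)
    (hu.continuousOn.mono hIcc), DifferentiableOn.mul (fun z hz => (hd z
    ⟨hz.1.le, hz.2.le⟩).differentiableWithinAt) (hu.differentiableOn.mono hIoo), ?_⟩
  obtain ⟨C, δ, hδ, h⟩ := (isStripKernel_kernelE hμ).bound (a - w.im) (b - w.im)
    (by linarith) (by linarith)
  refine ⟨C * Real.exp (δ * |w.re|) * M, δ, hδ, fun z hz => ?_⟩
  have h1 := h (z - w) ⟨by simpa using hz.1, by simpa using hz.2⟩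
  have hC : 0 ≤ C := nonneg_of_mul_nonneg_left ((norm_nonneg _).trans h1) (Real.exp_pos _)
  have h2 := exp_neg_mul_abs_add_le hδ (t := z.re) (s := -w.re) (abs_neg w.re).le
  rw [norm_mul]
  calc ‖kernelE μ (z - w)‖ * ‖u z‖
      ≤ (C * (Real.exp (δ * |w.re|) * Real.exp (-δ * |z.re|))) * M := by
        refine mul_le_mul (h1.trans ?_) (hu.bound z (hIcc hz)) (norm_nonneg _) (by positivity)
        refine mul_le_mul_of_nonneg_left ?_ hC
        simpa [sub_eq_add_neg] using h2
    _ = _ := by ring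

/-- Crossing the simple pole: for `1/2 < Im w < 1` the two representations agree. -/
theorem integral_kernelE_eq_add {μ : ℂ} (hμ : μ ∈ Complex.slitPlane) {u : ℂ → ℂ} {M : ℝ}
    (hu : IsUnitStripFunction u M) {a : ℝ} (ha : 0 ≤ a) {w : ℂ} (hw : w.im ∈ Set.Ioo a 1) :
    μ⁻¹ * ∫ t : ℝ, kernelE μ (t + -w) * u (t + (1 : ℝ) * Complex.I) =
      u w + ∫ t : ℝ, shiftedKernel μ (t + (a * Complex.I - w)) * u (t + a * Complex.I) := by
  have hμ0 : μ ≠ 0 := Complex.slitPlane_ne_zero hμ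
  have ha1 : a ≤ 1 := (hw.1.trans hw.2).le
  obtain ⟨hc, hd, C, δ, hδ, hb⟩ := kernelE_mul_strip hμ hu ha le_rfl (w := w) (a := a) (b := 1)
    (by linarith [hw.1, hw.2]) (by linarith [hw.1])
  set V : ℂ → ℂ := fun z => kernelE μ (z - w) * u z with hV
  have hker : ∀ c : ℝ, ∀ t : ℝ,
      shiftedKernel μ (t + (c * Complex.I - w)) * u (t + c * Complex.I) =
        -V (t + c * Complex.I) +
          Complex.I * (V (t + c * Complex.I) / (t + c * Complex.I - w)) := by
    intro c t
    simp only [hV, shiftedKernel, add_sub_assoc]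
    ring
  -- On the line `Im z = 1`, the shift by `-i` in the functional equation turns the shifted kernel
  -- at `z - w` into `μ⁻¹ E_μ` at `t - w`.
  have htop : ∀ t : ℝ, μ⁻¹ * (kernelE μ (t + -w) * u (t + (1 : ℝ) * Complex.I)) =
      shiftedKernel μ (t + ((1 : ℝ) * Complex.I - w)) * u (t + (1 : ℝ) * Complex.I) := by
    intro t
    have h := kernelE_sub_I_eq_shiftedKernel hμ0 (z := t + ((1 : ℝ) * Complex.I - w))
      (by simpa using ⟨hw.2, ha.trans_lt hw.1⟩)
    rw [show (t + ((1 : ℝ) * Complex.I - w) - Complex.I : ℂ) = t + -w by push_cast; ring] at h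
    rw [h]
    field_simp
  have iVa : Integrable fun t : ℝ => -V (t + a * Complex.I) :=
    (integrable_horizontal hδ hc hb (Set.left_mem_Icc.2 ha1)).neg
  have iV1 : Integrable fun t : ℝ => -V (t + (1 : ℝ) * Complex.I) :=
    (integrable_horizontal hδ hc hb (Set.right_mem_Icc.2 ha1)).neg
  have iDa := integrable_horizontal_div_sub hδ hc hb (Set.left_mem_Icc.2 ha1) hw.1.ne
  have iD1 := integrable_horizontal_div_sub hδ hc hb (Set.right_mem_Icc.2 ha1) hw.2.ne'
  have hshift := integral_horizontal_eq ha1 hδ hc hd hb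
  have hres := integral_div_sub_horizontal hδ hc hd hb hw
  rw [integral_sub iDa iD1] at hres
  -- As `E_μ(0) = 1/(2π)`, the residue term is exactly `i u(w)`, which the factor `i` in the shifted
  -- kernel turns into `u(w)` with coefficient one.
  have hVw : V w = (2 * Real.pi : ℂ)⁻¹ * u w := by rw [hV]; simp [kernelE_zero]
  rw [← integral_const_mul]
  simp only [htop, hker]
  rw [integral_add iV1 (iD1.const_mul _), integral_add iVa (iDa.const_mul _), integral_neg,
    integral_neg, integral_const_mul, integral_const_mul, hshift]
  rw [hVw] at hres
  have hpi : (Real.pi : ℂ) ≠ 0 := by exact_mod_cast Real.pi_ne_zero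
  have hres' : (2 * Real.pi * Complex.I * ((2 * Real.pi : ℂ)⁻¹ * u w)) = Complex.I * u w := by
    field_simp
  rw [hres'] at hres
  linear_combination (-Complex.I) * hres + (-u w) * Complex.I_sq

/-- After `shiftedKernel_eq`, the first piece moves up from height `a` to `1` and the second down
from `a` to `0`. In both cases the kernel argument becomes real. -/
theorem integral_shiftedKernel_I {μ : ℂ} (hμ : μ ∈ Complex.slitPlane) {u : ℂ → ℂ} {M : ℝ}
    (hu : IsUnitStripFunction u M) {a : ℝ} (ha : a ∈ Set.Ioo (0 : ℝ) 1) :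
    ∫ t : ℝ, shiftedKernel μ (t + (a * Complex.I - Complex.I)) * u (t + a * Complex.I) =
      -2 * (∫ t : ℝ, kernelE μ t * u (t + (1 : ℝ) * Complex.I)) -
        μ * ∫ t : ℝ, kernelE μ t * u t := by
  have hμ0 : μ ≠ 0 := Complex.slitPlane_ne_zero hμ
  obtain ⟨hc, hd, C, δ, hδ, hb⟩ := kernelE_mul_strip hμ hu ha.1.le le_rfl (w := Complex.I)
    (a := a) (b := 1) (by simpa using ha.1) (by simp)
  obtain ⟨hc', hd', C', δ', hδ', hb'⟩ := kernelE_mul_strip hμ hu le_rfl ha.2.le (w := 0)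
    (a := 0) (b := a) (by simp) (by simpa using ha.2)
  have h1 := integral_horizontal_eq ha.2.le hδ hc hd hb
  have h2 := integral_horizontal_eq ha.1.le hδ' hc' hd' hb'
  have i1 := integrable_horizontal hδ hc hb (Set.left_mem_Icc.2 ha.2.le)
  have i2 := integrable_horizontal hδ' hc' hb' (Set.right_mem_Icc.2 ha.1.le)
  have hk : ∀ t : ℝ,
      shiftedKernel μ (t + (a * Complex.I - Complex.I)) * u (t + a * Complex.I) =
      -2 * (kernelE μ (t + a * Complex.I - Complex.I) * u (t + a * Complex.I)) -
        μ * (kernelE μ (t + a * Complex.I - 0) * u (t + a * Complex.I)) := by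
    intro t
    rw [shiftedKernel_eq hμ0 (by simpa using ⟨ha.1, ha.2⟩), ← add_sub_assoc, sub_add_cancel,
      sub_zero]
    ring
  simp only [hk]
  rw [integral_sub (i1.const_mul _) (i2.const_mul _), integral_const_mul, integral_const_mul, h1,
    ← h2]
  simp

end ScalarIdentities

/-! ### Extensions of orbits to the strip -/

section OrbitExtensions

variable {X F : Type*} [NormedAddCommGroup X] [NormedSpace ℂ X]
  [NormedAddCommGroup F] [NormedSpace ℂ F]

theorem strip_I : strip Complex.I = Complex.im ⁻¹' Set.Icc 0 1 := by
  ext w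
  simp only [strip, Complex.I_im, mul_one, abs_one, Set.mem_ofPred_eq, Set.mem_preimage,
    Set.mem_Icc]
  refine and_congr_right fun h => ?_
  rw [abs_of_nonneg h]

theorem interior_strip_I : interior (strip Complex.I) = Complex.im ⁻¹' Set.Ioo 0 1 := by
  rw [strip_I, Complex.interior_preimage_im, interior_Icc]

theorem IsOrbitExtension.eqOn {B : X →ₗ[ℂ] F →ₗ[ℂ] ℂ} (hB : IsDualPair B) {U : ℝ → X →L[ℂ] X}
    {x : X} {f g : ℂ → X} (hf : IsOrbitExtension B U Complex.I x f)
    (hg : IsOrbitExtension B U Complex.I x g) : Set.EqOn f g (strip Complex.I) := by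
  intro w hw
  refine hB.ext fun φ => sub_eq_zero.1 ?_
  have hfc := hf.continuousOn_pairing φ
  have hgc := hg.continuousOn_pairing φ
  have hfd := hf.holomorphic φ
  have hgd := hg.holomorphic φ
  rw [interior_strip_I] at hfd hgd
  rw [strip_I] at hfc hgc hw
  exact eq_zero_of_unit_strip (f := fun w => B (f w) φ - B (g w) φ) (hfc.sub hgc) (hfd.sub hgd)
    (fun t => by simp [hf.eq_orbit, hg.eq_orbit]) hw.1 hw.2

/-- Weakly continuous operators commuting with the group map orbit extensions to orbit
extensions. -/
theorem IsOrbitExtension.map {B : X →ₗ[ℂ] F →ₗ[ℂ] ℂ} {U : ℝ → X →L[ℂ] X} {z : ℂ} {x : X}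
    {f : ℂ → X} (hf : IsOrbitExtension B U z x f) {A : X →L[ℂ] X} (hA : IsWeakContinuous B A)
    (hAU : ∀ t y, A (U t y) = U t (A y)) : IsOrbitExtension B U z (A x) (fun w => A (f w)) where
  continuousOn := (continuousOn_weakTopology_iff B).2 fun φ => by
    obtain ⟨ψ, hψ⟩ := hA.exists_adjoint φ
    simpa only [hψ] using hf.continuousOn_pairing ψ
  holomorphic φ := by
    obtain ⟨ψ, hψ⟩ := hA.exists_adjoint φ
    simpa only [hψ] using hf.holomorphic ψ
  eq_orbit t := by rw [hf.eq_orbit, hAU]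

theorem powGraph_map {B : X →ₗ[ℂ] F →ₗ[ℂ] ℂ} {U : ℝ → X →L[ℂ] X} {z : ℂ} {x y : X}
    (h : (x, y) ∈ powGraph B U z) {A : X →L[ℂ] X} (hA : IsWeakContinuous B A)
    (hAU : ∀ t y, A (U t y) = U t (A y)) : (A x, A y) ∈ powGraph B U z := by
  obtain ⟨f, hf, hfz⟩ := h
  exact ⟨_, hf.map hA hAU, congrArg A hfz⟩

/-- Both sides, as functions of `w`, extend the orbit of `U s x`, and such an extension is unique.
-/
theorem IsOrbitExtension.add_ofReal {B : X →ₗ[ℂ] F →ₗ[ℂ] ℂ} (hB : IsDualPair B)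
    {U : ℝ → X →L[ℂ] X} (hU : IsIsometryGroup B U) {x : X} {f : ℂ → X}
    (hf : IsOrbitExtension B U Complex.I x f) (s : ℝ) {w : ℂ} (hw : w ∈ strip Complex.I) :
    f (s + w) = U s (f w) := by
  have hcomm : ∀ t y, U s (U t y) = U t (U s y) := by
    intro t y
    rw [← ContinuousLinearMap.comp_apply, ← hU.map_add, add_comm, hU.map_add,
      ContinuousLinearMap.comp_apply]
  have h1 := hf.map (hU.weakContinuous s) hcomm
  have hmaps : Set.MapsTo (fun w : ℂ => (s : ℂ) + w) (strip Complex.I) (strip Complex.I) := by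
    rw [strip_I]
    intro w
    simp
  have hmaps' : Set.MapsTo (fun w : ℂ => (s : ℂ) + w) (interior (strip Complex.I))
      (interior (strip Complex.I)) := by
    rw [interior_strip_I]
    intro w
    simp
  have h2 : IsOrbitExtension B U Complex.I (U s x) (fun w => f (s + w)) :=
    { continuousOn := (continuousOn_weakTopology_iff B).2 fun φ =>
        (hf.continuousOn_pairing φ).comp (by fun_prop) hmaps
      holomorphic := fun φ => (hf.holomorphic φ).comp (by fun_prop) hmaps'
      eq_orbit := fun t => by
        rw [← hcomm, ← ContinuousLinearMap.comp_apply, ← hU.map_add, ← hf.eq_orbit]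
        push_cast
        rfl }
  exact h2.eqOn hB h1 hw

/-- Translation by the isometries `U_s` reduces the bound to the segment from `0` to `i`. There `f`
is weakly bounded by compactness, and uniform boundedness on the Banach space `F` gives a norm
bound. -/
theorem IsOrbitExtension.exists_norm_le [CompleteSpace F] {B : X →ₗ[ℂ] F →ₗ[ℂ] ℂ}
    (hB : IsDualPair B) {U : ℝ → X →L[ℂ] X} (hU : IsIsometryGroup B U) {x : X} {f : ℂ → X}
    (hf : IsOrbitExtension B U Complex.I x f) :
    ∃ M, ∀ w ∈ strip Complex.I, ‖f w‖ ≤ M := by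
  have hseg : ∀ η : Set.Icc (0 : ℝ) 1, (η.1 * Complex.I : ℂ) ∈ strip Complex.I := fun η => by
    rw [strip_I]
    simp
  obtain ⟨M, hM⟩ := banach_steinhaus (g := fun η : Set.Icc (0 : ℝ) 1 =>
    (B (f (η.1 * Complex.I))).mkContinuous _ (hB.norm_le_mul _)) (fun φ => by
      have hc : Continuous fun η : Set.Icc (0 : ℝ) 1 => B (f (η.1 * Complex.I)) φ :=
        (hf.continuousOn_pairing φ).comp_continuous (by fun_prop) hseg
      obtain ⟨C, hC⟩ := (isCompact_range hc).isBounded.exists_norm_le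
      exact ⟨C, fun η => hC _ ⟨η, rfl⟩⟩)
  refine ⟨M, fun w hw => ?_⟩
  have hw' : w.im ∈ Set.Icc (0 : ℝ) 1 := by
    rw [strip_I] at hw
    exact hw
  have h := hf.add_ofReal hB hU w.re (hseg ⟨w.im, hw'⟩)
  rw [Complex.re_add_im] at h
  rw [h, hU.norm_apply]
  have hM' := hM ⟨w.im, hw'⟩
  exact hB.norm_le_of_forall (fun φ => ContinuousLinearMap.le_of_opNorm_le _ hM' φ)
    ((norm_nonneg _).trans hM')

theorem IsOrbitExtension.exists_isUnitStripFunction [CompleteSpace F] {B : X →ₗ[ℂ] F →ₗ[ℂ] ℂ}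
    (hB : IsDualPair B) {U : ℝ → X →L[ℂ] X} (hU : IsIsometryGroup B U) {x : X} {f : ℂ → X}
    (hf : IsOrbitExtension B U Complex.I x f) (φ : F) :
    ∃ M, IsUnitStripFunction (fun w => B (f w) φ) M := by
  obtain ⟨M, hM⟩ := hf.exists_norm_le hB hU
  have hc := hf.continuousOn_pairing φ
  have hd := hf.holomorphic φ
  rw [interior_strip_I] at hd
  rw [strip_I] at hc hM
  exact ⟨M * ‖φ‖, hc, hd, fun w hw => (hB.norm_le_mul _ _).trans
    (mul_le_mul_of_nonneg_right (hM w hw) (norm_nonneg _))⟩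

theorem IsIsometryGroup.exists_weakIntegral {B : X →ₗ[ℂ] F →ₗ[ℂ] ℂ} (hB : IsDualPair B)
    (hXF : KreinProperty B) {U : ℝ → X →L[ℂ] X} (hU : IsIsometryGroup B U) {k : ℂ → ℂ} {a b : ℝ}
    (hk : IsStripKernel k a b) {w : ℂ} (hw : w.im ∈ Set.Ioo a b) (x : X) :
    ∃ y : X, ∀ φ, B y φ = ∫ t : ℝ, k (t + w) * B (U t x) φ := by
  obtain ⟨r, hr, C, δ, hδ, hb⟩ := hk.bound_line hw
  exact hXF.exists_weakIntegral (hk.continuous_line hw) hδ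
    (hb w (Metric.mem_closedBall_self hr.le)).2 (hU.continuous_pairing_orbit x)
    (fun φ => ⟨_, fun t => hU.norm_pairing_le hB t x φ⟩)

/-- The operator `Q` with kernel `μ⁻¹ E_μ` maps the range of the analytic generator `T` into its
domain, with `T Q T = T - 2 μ Q T - μ² Q` on the domain of `T`. -/
theorem powGraph_integral_kernelE [CompleteSpace F] {B : X →ₗ[ℂ] F →ₗ[ℂ] ℂ} (hB : IsDualPair B)
    (hXF : KreinProperty B) {U : ℝ → X →L[ℂ] X} (hU : IsIsometryGroup B U) {μ : ℂ}
    (hμ : μ ∈ Complex.slitPlane) {Q : X →L[ℂ] X}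
    (hQ : ∀ x φ, B (Q x) φ = μ⁻¹ * ∫ t : ℝ, kernelE μ t * B (U t x) φ) {x x' : X}
    (h : (x, x') ∈ powGraph B U Complex.I) :
    (Q x', x' - (2 * μ) • Q x' - μ ^ 2 • Q x) ∈ powGraph B U Complex.I := by
  have hμ0 : μ ≠ 0 := Complex.slitPlane_ne_zero hμ
  obtain ⟨f, hf, hfI⟩ := h
  simp only at hf hfI
  choose M hu using hf.exists_isUnitStripFunction hB hU
  have hline : ∀ (a : ℝ), a ∈ Set.Icc (0 : ℝ) 1 → ∀ t : ℝ,
      U t (f (a * Complex.I)) = f (t + a * Complex.I) := fun a ha t =>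
    (hf.add_ofReal hB hU t (by rw [strip_I]; simpa using ha)).symm
  have htop : ∀ t : ℝ, U t x' = f (t + (1 : ℝ) * Complex.I) := fun t => by
    rw [← hline 1 (by simp), Complex.ofReal_one, one_mul, hfI]
  have h1mem : (1 : ℝ) ∈ Set.Icc (0 : ℝ) 1 := by simp
  have h2mem : (1 / 2 : ℝ) ∈ Set.Icc (0 : ℝ) 1 := by constructor <;> norm_num
  -- `G₁` represents the extended orbit of `Q x'` below the top line; `G₂` represents it near that
  -- line, after crossing the pole. The level `1/2` is an arbitrary choice in `(0, 1)`.
  set G₁ : F → ℂ → ℂ := fun φ w =>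
    μ⁻¹ * ∫ t : ℝ, kernelE μ (t + -w) * B (f (t + (1 : ℝ) * Complex.I)) φ with hG₁
  set G₂ : F → ℂ → ℂ := fun φ w => B (f w) φ +
    ∫ t : ℝ, shiftedKernel μ (t + ((1 / 2 : ℝ) * Complex.I - w)) *
      B (f (t + (1 / 2 : ℝ) * Complex.I)) φ with hG₂
  have hG : ∀ φ, ∀ w : ℂ, w.im ∈ Set.Ioo (1 / 2 : ℝ) 1 → G₁ φ w = G₂ φ w := fun φ w hw =>
    integral_kernelE_eq_add hμ (hu φ) h2mem.1 hw
  have hG₁d : ∀ φ, ∀ w : ℂ, w.im ∈ Set.Ico (0 : ℝ) 1 → DifferentiableAt ℂ (G₁ φ) w := by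
    intro φ w hw
    have hd := ((isStripKernel_kernelE hμ).differentiableOn_integral
      ((hu φ).continuous_line h1mem) ((hu φ).bound_line h1mem)).differentiableAt
      (x := -w) ((isOpen_Ioo.preimage Complex.continuous_im).mem_nhds (by
        simp only [Set.mem_preimage, Complex.neg_im, Set.mem_Ioo]
        constructor <;> linarith [hw.1, hw.2]))
    exact (DifferentiableAt.fun_comp' w hd differentiableAt_id.neg).const_mul _
  have hG₂c : ∀ φ, ContinuousOn (G₂ φ) (Complex.im ⁻¹' Set.Ioc (1 / 2) 1) := by
    intro φ
    have hd := ((isStripKernel_shiftedKernel hμ).differentiableOn_integral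
      ((hu φ).continuous_line h2mem) ((hu φ).bound_line h2mem)).continuousOn
    refine ((hu φ).continuousOn.mono fun w hw => ⟨by linarith [hw.1], hw.2⟩).add
      (hd.comp (f := fun w : ℂ => ((1 / 2 : ℝ) : ℂ) * Complex.I - w) (by fun_prop) fun w hw => ?_)
    simp only [Set.mem_preimage, Complex.sub_im, Complex.im_ofReal_mul, Complex.I_im, Set.mem_Ioo]
    constructor <;> linarith [hw.1, hw.2]
  -- `G₁` and `G₂` only give functionals of `φ`; the Krein property realises them by vectors. Off
  -- the closed strip the value `0` is immaterial.
  have hex : ∀ w : ℂ, ∃ y : X, w ∈ Complex.im ⁻¹' Set.Icc 0 1 → ∀ φ,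
      (w.im < 1 → B y φ = G₁ φ w) ∧ (1 / 2 < w.im → B y φ = G₂ φ w) := by
    intro w
    by_cases hw : w ∈ Complex.im ⁻¹' Set.Icc 0 1
    swap
    · exact ⟨0, fun h => absurd h hw⟩
    rcases lt_or_ge w.im 1 with hlt | hge
    · obtain ⟨y, hy⟩ := hU.exists_weakIntegral hB hXF (isStripKernel_kernelE hμ) (w := -w) (by
        simp only [Complex.neg_im, Set.mem_Ioo]
        constructor <;> linarith [hw.1]) x'
      have hy1 : ∀ φ, B (μ⁻¹ • y) φ = G₁ φ w := fun φ => by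
        simp only [map_smul, LinearMap.smul_apply, smul_eq_mul, hy, htop, hG₁]
      exact ⟨μ⁻¹ • y, fun _ φ => ⟨fun _ => hy1 φ, fun h => (hy1 φ).trans (hG φ w ⟨h, hlt⟩)⟩⟩
    · obtain ⟨y, hy⟩ := hU.exists_weakIntegral hB hXF (isStripKernel_shiftedKernel hμ)
        (w := (1 / 2 : ℝ) * Complex.I - w) (by
          simp only [Complex.sub_im, Complex.im_ofReal_mul, Complex.I_im, Set.mem_Ioo]
          constructor <;> linarith [hw.2]) (f ((1 / 2 : ℝ) * Complex.I))
      refine ⟨f w + y, fun _ φ => ⟨fun h => absurd h hge.not_gt, fun _ => ?_⟩⟩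
      simp only [_root_.map_add, LinearMap.add_apply, hy, hline _ h2mem, hG₂]
  choose g hg using hex
  have hI : Complex.I ∈ Complex.im ⁻¹' Set.Icc 0 1 := by simp
  refine ⟨g, ⟨(continuousOn_weakTopology_iff B).2 fun φ => ?_, fun φ => ?_, fun t => ?_⟩, ?_⟩
  · rw [strip_I]
    intro w hw
    rcases lt_or_ge w.im 1 with hlt | hge
    · have hO : {z : ℂ | z.im < 1} ∈ 𝓝 w :=
        (isOpen_lt Complex.continuous_im continuous_const).mem_nhds hlt
      refine (hG₁d φ w ⟨hw.1, hlt⟩).continuousAt.continuousWithinAt.congr_of_eventuallyEq ?_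
        ((hg w hw φ).1 hlt)
      filter_upwards [self_mem_nhdsWithin, mem_nhdsWithin_of_mem_nhds hO] with z hz hz1
      exact (hg z hz φ).1 hz1
    · have hw2 : 1 / 2 < w.im := by linarith
      have hO : {z : ℂ | 1 / 2 < z.im} ∈ 𝓝 w :=
        (isOpen_lt continuous_const Complex.continuous_im).mem_nhds hw2
      have hc : ContinuousWithinAt (G₂ φ) (Complex.im ⁻¹' Set.Icc 0 1) w := by
        refine (hG₂c φ w ⟨hw2, hw.2⟩).mono_of_mem_nhdsWithin ?_
        filter_upwards [self_mem_nhdsWithin, mem_nhdsWithin_of_mem_nhds hO] with z hz hz1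
        exact ⟨hz1, hz.2⟩
      refine hc.congr_of_eventuallyEq ?_ ((hg w hw φ).2 hw2)
      filter_upwards [self_mem_nhdsWithin, mem_nhdsWithin_of_mem_nhds hO] with z hz hz1
      exact (hg z hz φ).2 hz1
  · rw [interior_strip_I]
    refine DifferentiableOn.congr (f := G₁ φ)
      (fun w hw => (hG₁d φ w ⟨hw.1.le, hw.2⟩).differentiableWithinAt) fun w hw => ?_
    exact (hg w ⟨hw.1.le, hw.2.le⟩ φ).1 hw.2
  · refine hB.ext fun φ => ?_
    rw [(hg t (by simp) φ).1 (by simp)]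
    obtain ⟨ψ, hψ⟩ := (hU.weakContinuous t).exists_adjoint φ
    rw [hψ, hQ, hG₁]
    simp only [← hψ]
    congr 1
    -- Translating the variable by `t` removes `t` from the kernel and turns `U_s x'` into `U_t U_s
    -- x'`.
    rw [← integral_add_right_eq_self (fun s : ℝ =>
      kernelE μ (s + -(t : ℂ)) * B (f (s + (1 : ℝ) * Complex.I)) φ) t]
    congr 1
    ext s
    rw [← htop, add_comm s t, hU.map_add, ContinuousLinearMap.comp_apply]
    congr 2
    push_cast
    ring
  · refine hB.ext fun φ => ?_
    simp only
    rw [(hg Complex.I hI φ).2 (by norm_num), hG₂]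
    simp only
    rw [integral_shiftedKernel_I hμ (hu φ) (by constructor <;> norm_num)]
    simp only [map_sub, LinearMap.sub_apply, map_smul, LinearMap.smul_apply, smul_eq_mul, hQ, hfI,
      htop, hf.eq_orbit]
    field_simp
    ring

end OrbitExtensions

/-! ### From the identities on the graph to the resolvent matrix -/

section Resolvent

theorem LinearPMap.apply_eq_of_mem_graph {R E G : Type*} [Ring R] [AddCommGroup E] [Module R E]
    [AddCommGroup G] [Module R G] {T : E →ₗ.[R] G} {x : E} {y : G} (h : (x, y) ∈ T.graph)
    (hx : x ∈ T.domain) : T ⟨x, hx⟩ = y := by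
  obtain ⟨z, hz, hzy⟩ := (LinearPMap.mem_graph_iff T).1 h
  simp only at hz hzy
  subst hz
  exact hzy

/-- A bounded operator `Q` that commutes with `T` and satisfies `T Q T = T - 2 μ Q T - μ² Q` on
the domain of `T` yields the resolvent of the ampliation of `T` at `-μ`. -/
theorem exists_isResolventAt_ampliation {X : Type*} [NormedAddCommGroup X] [NormedSpace ℂ X]
    {T : X →ₗ.[ℂ] X} {μ : ℂ} (hμ : μ ≠ 0) {Q : X →L[ℂ] X}
    (h₁ : ∀ x y, (x, y) ∈ T.graph → (Q x, Q y) ∈ T.graph)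
    (h₂ : ∀ x y, (x, y) ∈ T.graph → (Q y, y - (2 * μ) • Q y - μ ^ 2 • Q x) ∈ T.graph) :
    ∃ R : T.graph →L[ℂ] T.graph, IsResolventAt (ampliation T) (-μ) R ∧
      ∀ p : T.graph, (R p : X × X) = resolventMatrix μ Q (p : X × X) := by
  have hM : ∀ x y : X, resolventMatrix μ Q (x, y) =
      (-Q x + μ⁻¹ • x - μ⁻¹ • Q y, μ • Q x + Q y) := fun x y => by
    simp [resolventMatrix, sub_eq_add_neg]
  have hsnd : ∀ x y, (x, y) ∈ T.graph →
      (μ • Q x + Q y, y - μ • Q y - μ ^ 2 • Q x) ∈ T.graph := by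
    intro x y h
    have := T.graph.add_mem (T.graph.smul_mem μ (h₁ x y h)) (h₂ x y h)
    convert this using 1
    refine Prod.ext rfl ?_
    simp only [Prod.smul_mk, Prod.mk_add_mk]
    module
  -- The image pair is `μ⁻¹(x, y) - (Q x, Q y) - μ⁻¹(Q y, T Q y)`, a combination of elements of the
  -- graph.
  have hmem : ∀ p : T.graph, resolventMatrix μ Q (p : X × X) ∈ T.graph := by
    rintro ⟨⟨x, y⟩, h⟩
    have := T.graph.sub_mem (T.graph.sub_mem (T.graph.smul_mem μ⁻¹ h) (h₁ x y h))
      (T.graph.smul_mem μ⁻¹ (h₂ x y h))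
    rw [hM]
    convert this using 1
    simp only [Prod.smul_mk, Prod.mk_sub_mk]
    refine Prod.ext ?_ ?_
    · simp only
      module
    · simp only
      match_scalars <;> field_simp <;> ring
  let R : T.graph →L[ℂ] T.graph :=
    ((resolventMatrix μ Q).comp T.graph.subtypeL).codRestrict T.graph hmem
  have hR : ∀ p : T.graph, (R p : X × X) = resolventMatrix μ Q (p : X × X) := fun p => rfl
  have hdom : ∀ p : T.graph, R p ∈ (ampliation T).domain := by
    rintro ⟨⟨x, y⟩, h⟩
    have e := hR ⟨(x, y), h⟩
    rw [hM] at e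
    have hg := hmem ⟨(x, y), h⟩
    rw [hM] at hg
    change (R ⟨(x, y), h⟩ : X × X).1 ∈ T.domain ∧ (R ⟨(x, y), h⟩ : X × X).2 ∈ T.domain
    rw [e]
    exact ⟨LinearPMap.mem_domain_of_mem_graph hg,
      LinearPMap.mem_domain_of_mem_graph (hsnd x y h)⟩
  -- On the graph, `T` applied to the first component is the second one, so only the second
  -- component of the image remains to be computed.
  have hval : ∀ p : (ampliation T).domain, ∀ y : X × X, ((p : T.graph) : X × X).1 = y.1 →
      ∀ z : X, ((p : T.graph) : X × X).2 = y.2 → (y.2, z) ∈ T.graph →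
      ((ampliation T p : T.graph) : X × X) = (y.2, z) := by
    rintro ⟨⟨⟨x, y⟩, h⟩, hx, hy⟩ ⟨x', y'⟩ rfl z rfl hz
    exact Prod.ext (LinearPMap.apply_eq_of_mem_graph h hx) (LinearPMap.apply_eq_of_mem_graph hz hy)
  refine ⟨R, ⟨?_, hdom, ?_⟩, hR⟩
  · rintro ⟨⟨⟨x, y⟩, h⟩, hx, hy⟩
    have hyz : (y, T ⟨y, hy⟩) ∈ T.graph := T.mem_graph ⟨y, hy⟩
    set z := T ⟨y, hy⟩
    have e := hval ⟨⟨(x, y), h⟩, hx, hy⟩ (x, y) rfl z rfl hyz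
    -- `T Q y` is computed in two ways: by commutation from `z = T y`, and by the quadratic identity
    -- from `y = T x`.
    have e3 : Q z = y - (2 * μ) • Q y - μ ^ 2 • Q x := by
      have hd := LinearPMap.mem_domain_of_mem_graph (h₁ y z hyz)
      rw [← LinearPMap.apply_eq_of_mem_graph (h₁ y z hyz) hd,
        LinearPMap.apply_eq_of_mem_graph (h₂ x y h) hd]
    refine Subtype.ext ?_
    rw [hR]
    simp only [Submodule.coe_sub, Submodule.coe_smul, e, Prod.smul_mk, Prod.mk_sub_mk]
    rw [hM]
    simp only [map_sub, map_smul, e3]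
    refine Prod.ext ?_ ?_ <;> simp only <;> match_scalars <;> field_simp <;> ring
  · rintro ⟨⟨x, y⟩, h⟩
    have e : ((R ⟨(x, y), h⟩ : T.graph) : X × X) =
        (-Q x + μ⁻¹ • x - μ⁻¹ • Q y, μ • Q x + Q y) := (hR _).trans (hM x y)
    refine Subtype.ext ?_
    rw [Submodule.coe_sub, hval ⟨R ⟨(x, y), h⟩, hdom _⟩
      (-Q x + μ⁻¹ • x - μ⁻¹ • Q y, μ • Q x + Q y) (by rw [e]) _ (by rw [e]) (hsnd x y h),
      Submodule.coe_smul, e]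
    simp only [Prod.smul_mk, Prod.mk_sub_mk]
    refine Prod.ext ?_ ?_ <;> simp only <;> match_scalars <;> field_simp <;> ring

end Resolvent

/-! ### The operator `Q_μ` and the spectral inclusion -/

section Main

variable {X F : Type*} [NormedAddCommGroup X] [NormedSpace ℂ X]
  [NormedAddCommGroup F] [NormedSpace ℂ F]

theorem comm_of_weakIntegral {B : X →ₗ[ℂ] F →ₗ[ℂ] ℂ} (hB : IsDualPair B) {U : ℝ → X →L[ℂ] X}
    (hU : IsIsometryGroup B U) {k : ℝ → ℂ} {Q : X →L[ℂ] X}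
    (hQ : ∀ x φ, B (Q x) φ = ∫ t : ℝ, k t * B (U t x) φ) (s : ℝ) (x : X) :
    Q (U s x) = U s (Q x) := by
  refine hB.ext fun φ => ?_
  obtain ⟨ψ, hψ⟩ := (hU.weakContinuous s).exists_adjoint φ
  rw [hψ, hQ, hQ]
  simp only [← hψ]
  congr 1
  ext t
  rw [← ContinuousLinearMap.comp_apply, ← ContinuousLinearMap.comp_apply, ← hU.map_add,
    ← hU.map_add, add_comm]

/-- The two kernels can differ only at `t = 0`, where `E_μ` carries the continuous value. -/
theorem kernelF_ae_eq {μ : ℂ} (hμ : μ ≠ 0) :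
    kernelF μ =ᵐ[volume] fun t : ℝ => μ⁻¹ * kernelE μ t := by
  filter_upwards [compl_mem_ae_iff.2 (measure_singleton (0 : ℝ))] with t ht
  exact kernelF_eq hμ ht

/-- The integral operator `Q_μ` and the resolvent of the ampliation at `-μ`. -/
theorem exists_resolvent_of_mem_slitPlane [CompleteSpace F] {B : X →ₗ[ℂ] F →ₗ[ℂ] ℂ}
    (hB : IsDualPair B) (hXF : KreinProperty B) (hFX : KreinProperty B.flip) {U : ℝ → X →L[ℂ] X}
    (hU : IsIsometryGroup B U) {μ : ℂ} (hμ : μ ∈ Complex.slitPlane) :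
    Integrable (kernelF μ) ∧ ∃ Q : X →L[ℂ] X, IsWeakContinuous B Q ∧
      (∀ x : X, IsWeakIntegral B (kernelF μ) (fun t => U t x) (Q x)) ∧
      ∃ R : (analyticGenerator B U).graph →L[ℂ] (analyticGenerator B U).graph,
        IsResolventAt (ampliation (analyticGenerator B U)) (-μ) R ∧
        ∀ p : (analyticGenerator B U).graph,
          (R p : X × X) = resolventMatrix μ Q (p : X × X) := by
  have hμ0 : μ ≠ 0 := Complex.slitPlane_ne_zero hμ
  have hae := kernelF_ae_eq hμ0
  obtain ⟨C, δ, hδ, hb⟩ := exists_kernelE_bound hμ (ρ := 0) one_pos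
  have hkc : Continuous fun t : ℝ => μ⁻¹ * kernelE μ t :=
    continuous_const.mul (continuous_kernelE_ofReal μ)
  have hkb : ∀ t : ℝ, ‖μ⁻¹ * kernelE μ t‖ ≤ ‖μ⁻¹‖ * C * Real.exp (-δ * |t|) := by
    intro t
    rw [norm_mul, mul_assoc]
    refine mul_le_mul_of_nonneg_left ?_ (norm_nonneg _)
    simpa using hb t (by simp)
  obtain ⟨Q, hQw, hQ⟩ := hU.exists_integral_operator hB hXF hFX hkc hδ hkb
  have hgr : (analyticGenerator B U).graph = powGraph B U Complex.I := graph_groupPow hB U Complex.I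
  refine ⟨(integrable_of_exp_bound hkc.aestronglyMeasurable hδ hkb).congr hae.symm, Q, hQw,
    fun x φ => ?_, exists_isResolventAt_ampliation hμ0 (fun x y h => ?_) fun x y h => ?_⟩
  · have hae' : (fun t => kernelF μ t * B (U t x) φ) =ᵐ[volume]
        fun t : ℝ => μ⁻¹ * kernelE μ t * B (U t x) φ := by
      filter_upwards [hae] with t ht
      rw [ht]
    exact ⟨(hQ x φ).1.congr hae'.symm, (hQ x φ).2.trans (integral_congr_ae hae'.symm)⟩
  · rw [hgr] at h ⊢
    exact powGraph_map h hQw (comm_of_weakIntegral hB hU fun x φ => (hQ x φ).2)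
  · rw [hgr] at h ⊢
    refine powGraph_integral_kernelE hB hXF hU hμ (fun x φ => ?_) h
    rw [(hQ x φ).2, ← integral_const_mul]
    simp only [mul_assoc]

theorem mem_slitPlane_of_not_nonpos {μ : ℂ} (hμ : ¬ ∃ r : ℝ, r ≤ 0 ∧ μ = r) :
    μ ∈ Complex.slitPlane := by
  rw [Complex.mem_slitPlane_iff]
  by_contra! h
  exact hμ ⟨μ.re, h.1, Complex.ext (by simp) (by simpa using h.2)⟩

end Main

end

theorem mainTheorem1 {X F : Type*}
    [NormedAddCommGroup X] [NormedSpace ℂ X] [CompleteSpace X]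
    [NormedAddCommGroup F] [NormedSpace ℂ F] [CompleteSpace F]
    (B : X →ₗ[ℂ] F →ₗ[ℂ] ℂ) (hB : IsDualPair B)
    (hXF : KreinProperty B) (hFX : KreinProperty B.flip)
    (U : ℝ → X →L[ℂ] X) (hU : IsIsometryGroup B U) :
    pmapSpectrum (ampliation (analyticGenerator B U)) ⊆ {c : ℂ | ∃ r : ℝ, 0 ≤ r ∧ c = r} ∧
    ∀ μ : ℂ, (¬ ∃ r : ℝ, r ≤ 0 ∧ μ = r) →
      MeasureTheory.Integrable (kernelF μ) ∧
      ∃ Q : X →L[ℂ] X, IsWeakContinuous B Q ∧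
        (∀ x : X, IsWeakIntegral B (kernelF μ) (fun t => U t x) (Q x)) ∧
        ∃ R : (analyticGenerator B U).graph →L[ℂ] (analyticGenerator B U).graph,
          IsResolventAt (ampliation (analyticGenerator B U)) (-μ) R ∧
          ∀ p : (analyticGenerator B U).graph,
            (R p : X × X) = resolventMatrix μ Q (p : X × X) := by
  refine ⟨fun c hc => ?_, fun μ hμ =>
    exists_resolvent_of_mem_slitPlane hB hXF hFX hU (mem_slitPlane_of_not_nonpos hμ)⟩
  by_contra hcr
  have hμ : ¬ ∃ r : ℝ, r ≤ 0 ∧ -c = r := by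
    rintro ⟨r, hr, h⟩
    exact hcr ⟨-r, neg_nonneg.2 hr, by rw [Complex.ofReal_neg, ← h, neg_neg]⟩
  obtain ⟨-, Q, -, -, R, hR, -⟩ :=
    exists_resolvent_of_mem_slitPlane hB hXF hFX hU (mem_slitPlane_of_not_nonpos hμ)
  rw [neg_neg] at hR
  exact hc ⟨R, hR⟩
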